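/- A local ring is a commutative Noetherian ring with a unique maximal ideal; a homomorphism $\varphi\colon (R,\mathfrak m,k)\to(S,\mathfrak n,l)$ of local rings is local if $\varphi(\mathfrak m)\subseteq\mathfrak n$. Let $\mathsf D(R)$ be the derived category of $R$-modules, and let $\mathsf D^{+}_{f}(R)$ be its full subcategory of complexes $M$ (with lower grading) such that each $\mathrm H_n(M)$ is a finite $R$-module and $\mathrm H_n(M)=0$ for $n\ll 0$. For $L$ in $\mathsf D^{+}_{f}(R)$ and a complex $M$ of $S$-modules, $L\otimes^{\mathbf L}_RM$ is viewed in $\mathsf D(S)$ through the action of $S$ on $M$, and $\operatorname{Tor}^R_n(L,M)=\mathrm H_n(L\otimes^{\mathbf L}_RM)$. For a local homomorphism $\varphi\colon (R,\mathfrak m,k)\to(S,\mathfrak n,l)$ let $\boldsymbol y$ be a minimal set of generators of $\mathfrak n$ modulo $\mathfrak mS$, that is, a set of $\operatorname{edim}(S/\mathfrak mS)$ elements of $S$ whose image in $S/\mathfrak mS$ generates $\mathfrak n/\mathfrak mS$. For $M$ in $\mathsf D^{+}_{f}(S)$ let $K[\boldsymbol y;M]=K[\boldsymbol y;S]\otimes_SM$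 be the Koszul complex. The $n$th Betti number of $M$ over $\varphi$ is $$\beta^{\varphi}_n(M)=\operatorname{rank}_l\operatorname{Tor}^R_n(k,K[\boldsymbol y;M])$$ (a finite number that does not depend on $\boldsymbol y$). The curvature and the complexity of $M$ over $\varphi$ are $$\operatorname{curv}_\varphi M=\limsup_{n}\sqrt[n]{\beta^\varphi_n(M)}\in[0,\infty],$$ $$\operatorname{cx}_\varphi M=\inf\{d\in\mathbb N \mid \text{there is } c\in\mathbb R \text{ with } \beta^\varphi_n(M)\le c\,n^{d-1}\text{ for all } n\gg0\}\in\mathbb N\cup\{\infty\}.$$ Let $\rho\colon R'\to R$ and $\varphi\colon R\to S$ be local homomorphisms. For each $L$ in $\mathsf D^{+}_{f}(R)$ and each $M$ in $\mathsf D^{+}_{f}(S)$ there are inequalities $$\operatorname{curv}_{\varphi\circ\rho}(L\otimes^{\mathbf L}_RM)\le\max\{\operatorname{curv}_\rho L,\operatorname{curv}_\varphi M\},\qquad \operatorname{cx}_{\varphi\circ\rho}(L\otimes^{\mathbf L}_RM)\le\operatorname{cx}_\rho L+\operatorname{cx}_\varphi M.$$ -/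

import Mathlib

open CategoryTheory Limits Filter
open scoped ENNReal NNReal

universe u

noncomputable section

namespace LocalHomInvariants

/-! ### Complexes

An object of the derived category `D(R)` is a complex of `R`-modules. A complex with lower grading
`⋯ ⟶ M_{n+1} ⟶ M_n ⟶ M_{n-1} ⟶ ⋯` is written with upper grading `M^i = M_{-i}`. -/

/-- Complexes of `R`-modules. -/
abbrev Cpx (R : Type u) [CommRing R] := CochainComplex (ModuleCat.{u} R) ℤ

/-- The homology module `H_n(M) = H^{-n}(M)`, in lower grading. -/
abbrev H {R : Type u} [CommRing R] (n : ℤ) (M : Cpx R) : ModuleCat.{u} R :=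
  M.homology (-n)

/-- `H_n(M) = 0` for `n ≪ 0`. -/
def HomologyBoundedBelow {R : Type u} [CommRing R] (M : Cpx R) : Prop :=
  ∃ a : ℤ, ∀ n < a, Subsingleton (H n M)

/-- `M` is in `D^+_f(R)`: each `H_n(M)` is a finite `R`-module, and `H_n(M) = 0` for `n ≪ 0`. -/
structure InDPlusF {R : Type u} [CommRing R] (M : Cpx R) : Prop where
  finite : ∀ n : ℤ, Module.Finite R (H n M)
  bounded : HomologyBoundedBelow M

/-! ### Derived tensor products -/

/-- `π : P ⟶ L` is a projective resolution of the complex `L`: a quasi-isomorphism from a complex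
of projective modules with `P_n = 0` for `n ≪ 0`. -/
structure IsProjRes {R : Type u} [CommRing R] {P L : Cpx R} (π : P ⟶ L) : Prop where
  projective : ∀ i : ℤ, Projective (P.X i)
  bounded : ∃ b : ℤ, P.IsStrictlyLE b
  quasiIso : QuasiIso π

theorem HomologyBoundedBelow.exists_isLE {R : Type u} [CommRing R] {M : Cpx R}
    (hM : HomologyBoundedBelow M) : ∃ b : ℤ, M.IsLE b := by
  obtain ⟨a, ha⟩ := hM
  refine ⟨-a, (CochainComplex.isLE_iff _ _).2 fun i hi => ?_⟩
  rw [HomologicalComplex.exactAt_iff_isZero_homology]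
  obtain ⟨n, rfl⟩ : ∃ n : ℤ, i = -n := ⟨-i, by simp⟩
  have := ha n (by lia)
  exact ModuleCat.isZero_of_subsingleton (H n M)

theorem exists_isProjRes {R : Type u} [CommRing R] {L : Cpx R} (hL : HomologyBoundedBelow L) :
    ∃ (P : Cpx R) (π : P ⟶ L), IsProjRes π := by
  obtain ⟨b, hb⟩ := hL.exists_isLE
  let K := L.truncLE b
  let e := CochainComplex.opEquivalence (ModuleCat.{u} R)
  let K' := e.functor.obj (Opposite.op K)
  have hK' : K'.IsStrictlyGE (-b) := by
    rw [CochainComplex.isStrictlyGE_iff]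
    intro i hi
    exact (K.isZero_of_isStrictlyLE b (-i) (by lia)).op
  obtain ⟨J, i, hi, hJ, hJb⟩ := CochainComplex.Plus.modelCategoryQuillen.exists_quasiIso_injective K' (-b)
  let P : Cpx R := (e.inverse.obj J).unop
  let g : P ⟶ K := (e.unitIso.hom.app (Opposite.op K) ≫ e.inverse.map i).unop
  have hg : QuasiIso g := by
    have h1 : g = (e.inverse.map i).unop ≫ (e.unitIso.hom.app (Opposite.op K)).unop := rfl
    have h2 : QuasiIso (e.inverse.map i).unop := by
      rw [quasiIso_iff]
      intro n
      rw [quasiIsoAt_iff' _ (n - 1) n (n + 1) (by simp) (by simp),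
        ← ShortComplex.quasiIso_opMap_iff]
      have h3 := (quasiIsoAt_iff' i (-(n + 1)) (-n) (-(n - 1))
        (by simp; ring) (by simp; ring)).1
        inferInstance
      exact h3
    rw [h1]
    infer_instance
  refine ⟨P, g ≫ L.ιTruncLE b, ⟨fun n => ?_, ⟨b, ?_⟩, inferInstance⟩⟩
  · have := hJ (-n)
    exact inferInstanceAs (Projective (Opposite.unop (J.X (-n))))
  · rw [CochainComplex.isStrictlyLE_iff]
    intro n hn
    exact (J.isZero_of_isStrictlyGE (-b) (-n) (by lia)).unop

/-- A chosen projective resolution of `L`; it is unique up to homotopy equivalence. -/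
def projRes {R : Type u} [CommRing R] (L : Cpx R) (hL : HomologyBoundedBelow L) : Cpx R :=
  (exists_isProjRes hL).choose

instance extendScalars_additive {R S : Type u} [CommRing R] [CommRing S] (φ : R →+* S) :
    (ModuleCat.extendScalars.{u, u, u} φ).Additive :=
  (ModuleCat.extendRestrictScalarsAdj φ).left_adjoint_additive

/-- `P ⊗_R M` for a complex `P` of `R`-modules and a complex `M` of `S`-modules, as a complex of
`S`-modules through the action on `M`; it is formed as `(S ⊗_R P) ⊗_S M`. -/
def tensor {R S : Type u} [CommRing R] [CommRing S] (φ : R →+* S) (P : Cpx R) (M : Cpx S) :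
    Cpx S :=
  HomologicalComplex.tensorObj
    (((ModuleCat.extendScalars.{u, u, u} φ).mapHomologicalComplex (ComplexShape.up ℤ)).obj P) M

/-- The derived tensor product `L ⊗^L_R M` in `D(S)`. -/
def derivedTensor {R S : Type u} [CommRing R] [CommRing S] (φ : R →+* S) (L : Cpx R)
    (hL : HomologyBoundedBelow L) (M : Cpx S) : Cpx S :=
  tensor φ (projRes L hL) M

/-- `Tor^R_n(L, M) = H_n(L ⊗^L_R M)`, an `S`-module. -/
def Tor {R S : Type u} [CommRing R] [CommRing S] (φ : R →+* S) (n : ℤ) (L : Cpx R)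
    (hL : HomologyBoundedBelow L) (M : Cpx S) : ModuleCat.{u} S :=
  H n (derivedTensor φ L hL M)

/-! ### Koszul complexes -/

/-- The complex `0 ⟶ S --x--> S ⟶ 0` in lower degrees `1` and `0`. -/
def koszulOne {S : Type u} [CommRing S] (x : S) : Cpx S :=
  HomologicalComplex.double (x • 𝟙 (ModuleCat.of S S))
    (show (ComplexShape.up ℤ).Rel (-1) 0 from by simp)

/-- The Koszul complex `K[x₁, …, xₑ; S]`, the tensor product of the complexes
`0 ⟶ S --xᵢ--> S ⟶ 0`. -/
def koszul {S : Type u} [CommRing S] : List S → Cpx S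
  | [] => (HomologicalComplex.single (ModuleCat.{u} S) (ComplexShape.up ℤ) 0).obj (ModuleCat.of S S)
  | x :: xs => HomologicalComplex.tensorObj (koszulOne x) (koszul xs)

/-- `K[x; M] = K[x; S] ⊗_S M`. -/
def koszulOn {S : Type u} [CommRing S] (x : List S) (M : Cpx S) : Cpx S :=
  HomologicalComplex.tensorObj (koszul x) M

/-! ### Betti numbers over a local homomorphism -/

open IsLocalRing

section

variable {R S : Type u} [CommRing R] [IsLocalRing R]
  [CommRing S] [IsLocalRing S] [IsNoetherianRing S]

/-- The ideal `𝔫 / 𝔪S` of `S / 𝔪S`. -/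
def maxIdealMod (φ : R →+* S) : Ideal (S ⧸ (maximalIdeal R).map φ) :=
  (maximalIdeal S).map (Ideal.Quotient.mk ((maximalIdeal R).map φ))

/-- `edim φ = edim (S / 𝔪S)`, the minimal number of generators of `𝔫 / 𝔪S`. -/
def edim (φ : R →+* S) : ℕ := (maxIdealMod φ).spanFinrank

/-- `y` is a minimal set of generators of `𝔫` modulo `𝔪S`: it has `edim φ` elements and its image
in `S / 𝔪S` generates `𝔫 / 𝔪S`. -/
structure IsMinGen (φ : R →+* S) (y : List S) : Prop where
  length_eq : y.length = edim φ
  span_eq : Ideal.span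
    (Ideal.Quotient.mk ((maximalIdeal R).map φ) '' {a | a ∈ y}) = maxIdealMod φ

theorem exists_isMinGen (φ : R →+* S) : ∃ y : List S, IsMinGen φ y := by
  obtain ⟨s, hs, hspan⟩ := Submodule.FG.exists_span_finset_card_eq_spanFinrank
    (IsNoetherian.noetherian (maxIdealMod φ))
  refine ⟨s.toList.map Quotient.out, by simpa [edim] using hs, ?_⟩
  rw [← hspan]
  congr 1
  ext a
  simp only [List.mem_map, Finset.mem_toList, Set.mem_image, Set.mem_ofPred_eq, Finset.mem_coe]
  constructor
  · rintro ⟨_, ⟨b, hb, rfl⟩, rfl⟩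
    rwa [show Ideal.Quotient.mk ((maximalIdeal R).map φ) (Quotient.out b) = b from
      Quotient.out_eq b]
  · intro ha
    exact ⟨Quotient.out a, ⟨a, ha, rfl⟩, Quotient.out_eq a⟩

/-- A chosen minimal set of generators of `𝔫` modulo `𝔪S`; the Betti numbers do not depend on
it. -/
def minGen (φ : R →+* S) : List S := (exists_isMinGen φ).choose

variable (R) in
/-- The residue field `k` of `R`, as a complex of `R`-modules concentrated in degree `0`. -/
def residueCpx : Cpx R :=
  (HomologicalComplex.single (ModuleCat.{u} R) (ComplexShape.up ℤ) 0).obj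
    (ModuleCat.of R (ResidueField R))

variable (R) in
theorem residueCpx_bounded : HomologyBoundedBelow (residueCpx R) := by
  refine ⟨0, fun n hn => ModuleCat.subsingleton_of_isZero ?_⟩
  exact (HomologicalComplex.exactAt_iff_isZero_homology _ _).1
    (HomologicalComplex.exactAt_single_obj _ _ _ _ (by lia))

/-- The `n`-th Betti number `rank_l Tor^R_n(k, K[y; M])` of `M` over `φ`. The `S`-module
`Tor^R_n(k, K[y; M])` is annihilated by `𝔫`, so its rank over `l = S / 𝔫` is its length over `S`. -/
def betti (φ : R →+* S) (M : Cpx S) (n : ℤ) : ℕ∞ :=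
  Module.length S (Tor φ n (residueCpx R) (residueCpx_bounded R) (koszulOn (minGen φ) M))

/-- The curvature `curv_φ M = limsup_n (β_n^φ(M))^{1/n}`. -/
def curv (φ : R →+* S) (M : Cpx S) : ℝ≥0∞ :=
  limsup (fun n : ℕ => (betti φ M n : ℝ≥0∞) ^ (1 / (n : ℝ))) atTop

/-- The complexity `cx_φ M`: the infimum of the `d ∈ ℕ` such that, for some `c`,
`β_n^φ(M) ≤ c n^{d-1}` holds for all `n ≫ 0`; it is `∞` if there is no such `d`. -/
def cx (φ : R →+* S) (M : Cpx S) : ℕ∞ :=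
  ⨅ (d : ℕ) (_ : ∃ c : ℝ≥0, ∀ᶠ n : ℕ in atTop,
    (betti φ M n : ℝ≥0∞) ≤ c * (n : ℝ≥0∞) ^ ((d : ℤ) - 1)), (d : ℕ∞)

end

end LocalHomInvariants

end

/-! Everything follows from one estimate (`betti_derivedTensor_le`): the Betti numbers of `L ⊗ M`
over `φ ∘ ρ` are bounded by the convolution of those of `L` over `ρ` and of `M` over `φ`. The ranges
of summation are finite, with ends shifted by constants. The rest is calculus: if both factors are
`O(c^n)`, their convolution is `O(n c^n)`, and the linear factor is invisible to the curvature;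
polynomial growth of degrees `d - 1` and `e - 1` convolves to degree `d + e - 1`.

Let `k'` be the residue field of `R'`, let `x`, `y`, `z` be the chosen minimal generating lists for
`ρ`, `φ`, `φ ∘ ρ`, and let `w` be the image of `x` followed by `y`. Put `W = k' ⊗ (L ⊗ M)`, all
products derived. Two comparisons give the estimate.

Changing the Koszul complex. On both `K[z] ⊗ W` and `K[w] ⊗ W` every element of the maximal ideal of
`S` is null-homotopic, because elements coming from `R'` are null-homotopic on a resolution of `k'`
and Koszul generators are null-homotopic on their Koszul complex. Tensoring with a Koszul complex on
one null-homotopic element replaces the length function `f` of cohomology by `f i + f (i + 1)`.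
Computing `K[z] ⊗ K[w] ⊗ W` in two ways and cancelling this injective operator yields
`lengths_koszul_le`: since `z` is not longer than `w`, the lengths for `z` are at most those for
`w`.

Dévissage. Regrouping identifies `K[w] ⊗ W` with `X ⊗ V`, where `X = k' ⊗ K[x; L]` over `R` has
cohomology of finite length given by the Betti numbers of `L`, and `V = K[y; M]`. Copies of the
residue field `k` of `R` are removed one at a time from the top cohomology of `X`; each contributes
a shift of `k ⊗ V`, whose lengths are the Betti numbers of `M`. This is
`ProjBdd.length_homology_tensor_le`. -/

noncomputable section

namespace LocalHomInvariants

open scoped MonoidalCategory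
open MonoidalCategory (curriedTensor)

/-! ### Tensor products of complexes and degreewise splittings -/

section TensorBasics

variable {S : Type u} [CommRing S]

/-- The tensor product of complexes of `S`-modules. -/
abbrev tens (A B : Cpx S) : Cpx S := HomologicalComplex.tensorObj A B

/-- The inclusion of the summand `A^i ⊗ B^j` of `(A ⊗ B)^n`. -/
def tι (A B : Cpx S) (i j n : ℤ) (h : i + j = n) : A.X i ⊗ B.X j ⟶ (tens A B).X n :=
  HomologicalComplex.ιTensorObj A B i j n h

theorem tens_hom_ext {A B : Cpx S} {n : ℤ} {Z : ModuleCat.{u} S} {f g : (tens A B).X n ⟶ Z}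
    (h : ∀ i j (h : i + j = n), tι A B i j n h ≫ f = tι A B i j n h ≫ g) : f = g :=
  HomologicalComplex.mapBifunctor.hom_ext h

/-- Maps out of `(A ⊗ B)^n`. -/
def tdesc {A B : Cpx S} {n : ℤ} {Z : ModuleCat.{u} S}
    (f : ∀ i j (_ : i + j = n), A.X i ⊗ B.X j ⟶ Z) : (tens A B).X n ⟶ Z :=
  HomologicalComplex.mapBifunctorDesc f

@[simp]
theorem tι_desc {A B : Cpx S} {n : ℤ} {Z : ModuleCat.{u} S}
    (f : ∀ i j (_ : i + j = n), A.X i ⊗ B.X j ⟶ Z) (i j : ℤ) (h : i + j = n) :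
    tι A B i j n h ≫ tdesc f = f i j h :=
  HomologicalComplex.ι_mapBifunctorDesc (K₁ := A) (K₂ := B) (F := curriedTensor _)
    (c := ComplexShape.up ℤ) f i j h

@[simp]
theorem tι_desc_assoc {A B : Cpx S} {n : ℤ} {Z Z' : ModuleCat.{u} S}
    (f : ∀ i j (_ : i + j = n), A.X i ⊗ B.X j ⟶ Z) (i j : ℤ) (h : i + j = n) (k : Z ⟶ Z') :
    tι A B i j n h ≫ tdesc f ≫ k = f i j h ≫ k := by
  rw [← Category.assoc, tι_desc]

theorem tι_d (A B : Cpx S) (i j n i' j' n' : ℤ) (h : i + j = n) (hi : i + 1 = i') (hj : j + 1 = j')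
    (hn : n + 1 = n') :
    tι A B i j n h ≫ (tens A B).d n n' =
      (A.d i i' ▷ B.X j) ≫ tι A B i' j n' (by lia)
        + i.negOnePow • (A.X i ◁ B.d j j') ≫ tι A B i j' n' (by lia) := by
  have h1 : HomologicalComplex.mapBifunctor.d₁ A B (curriedTensor _) (ComplexShape.up ℤ) i j n' =
      (A.d i i' ▷ B.X j) ≫ tι A B i' j n' (by lia) :=
    (HomologicalComplex.mapBifunctor.d₁_eq A B (curriedTensor _) (ComplexShape.up ℤ)
      (show (ComplexShape.up ℤ).Rel i i' from hi) j n'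
      (show i' + j = n' by lia)).trans (one_smul _ _)
  have h2 : HomologicalComplex.mapBifunctor.d₂ A B (curriedTensor _) (ComplexShape.up ℤ) i j n' =
      i.negOnePow • (A.X i ◁ B.d j j') ≫ tι A B i j' n' (by lia) :=
    (HomologicalComplex.mapBifunctor.d₂_eq A B (curriedTensor _) (ComplexShape.up ℤ) i
      (show (ComplexShape.up ℤ).Rel j j' from hj) n'
      (show i + j' = n' by lia))
  rw [← h1, ← h2, ← HomologicalComplex.mapBifunctor.ι_D₁ A B _ _ n n' i j h,
    ← HomologicalComplex.mapBifunctor.ι_D₂ A B _ _ n n' i j h]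
  exact Preadditive.comp_add _ _ _ _ _ _

theorem tι_d_assoc (A B : Cpx S) (i j n i' j' n' : ℤ) (h : i + j = n) (hi : i + 1 = i')
    (hj : j + 1 = j') (hn : n + 1 = n') {Z : ModuleCat.{u} S} (k : (tens A B).X n' ⟶ Z) :
    tι A B i j n h ≫ (tens A B).d n n' ≫ k =
      ((A.d i i' ▷ B.X j) ≫ tι A B i' j n' (by lia)
        + i.negOnePow • (A.X i ◁ B.d j j') ≫ tι A B i j' n' (by lia)) ≫ k := by
  rw [← Category.assoc, tι_d A B i j n i' j' n' h hi hj hn]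

/-- The tensor product of maps of complexes. -/
def tmap {A A' B B' : Cpx S} (f : A ⟶ A') (g : B ⟶ B') : tens A B ⟶ tens A' B' :=
  HomologicalComplex.tensorHom f g

@[simp]
theorem tι_map {A A' B B' : Cpx S} (f : A ⟶ A') (g : B ⟶ B') (i j n : ℤ) (h : i + j = n) :
    tι A B i j n h ≫ (tmap f g).f n = (f.f i ⊗ₘ g.f j) ≫ tι A' B' i j n h := by
  rw [MonoidalCategory.tensorHom_def, Category.assoc]
  exact HomologicalComplex.ι_mapBifunctorMap f g (curriedTensor _) (ComplexShape.up ℤ) i j n h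

@[simp]
theorem tι_map_assoc {A A' B B' : Cpx S} (f : A ⟶ A') (g : B ⟶ B') (i j n : ℤ) (h : i + j = n)
    {Z : ModuleCat.{u} S} (k : (tens A' B').X n ⟶ Z) :
    tι A B i j n h ≫ (tmap f g).f n ≫ k = (f.f i ⊗ₘ g.f j) ≫ tι A' B' i j n h ≫ k := by
  rw [← Category.assoc, tι_map, Category.assoc]

theorem tens_ext {A B C : Cpx S} {f g : tens A B ⟶ C}
    (h : ∀ i j n (h : i + j = n), tι A B i j n h ≫ f.f n = tι A B i j n h ≫ g.f n) : f = g := by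
  ext n : 1
  exact tens_hom_ext fun i j hij => h i j n hij

theorem tmap_add {A B : Cpx S} (f g : A ⟶ B) (V : Cpx S) :
    tmap (f + g) (𝟙 V) = tmap f (𝟙 V) + tmap g (𝟙 V) := tens_ext fun i j n h => by
  rw [HomologicalComplex.add_f_apply, Preadditive.comp_add, tι_map, tι_map, tι_map]
  simp [MonoidalPreadditive.add_whiskerRight]

/-- The functor `- ⊗_S V` on complexes of `S`-modules. -/
def tensorR (V : Cpx S) : Cpx S ⥤ Cpx S where
  obj A := tens A V
  map f := tmap f (𝟙 V)
  map_id A := tens_ext fun i j n h => by simp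
  map_comp f g := tens_ext fun i j n h => by simp

instance (V : Cpx S) : (tensorR V).Additive where
  map_add := tmap_add _ _ V

/-- The tensor product of a map of graded modules with a complex. -/
def gradedTens {A B : Cpx S} (V : Cpx S) (r : ∀ i, A.X i ⟶ B.X i) (n : ℤ) :
    (tens A V).X n ⟶ (tens B V).X n :=
  tdesc fun i j h => (r i ▷ V.X j) ≫ tι B V i j n h

@[simp]
theorem tι_gradedTens {A B : Cpx S} (V : Cpx S) (r : ∀ i, A.X i ⟶ B.X i) (i j n : ℤ)
    (h : i + j = n) :
    tι A V i j n h ≫ gradedTens V r n = (r i ▷ V.X j) ≫ tι B V i j n h :=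
  tι_desc _ i j h

@[simp]
theorem tι_gradedTens_assoc {A B : Cpx S} (V : Cpx S) (r : ∀ i, A.X i ⟶ B.X i) (i j n : ℤ)
    (h : i + j = n) {Z : ModuleCat.{u} S} (k : (tens B V).X n ⟶ Z) :
    tι A V i j n h ≫ gradedTens V r n ≫ k = (r i ▷ V.X j) ≫ tι B V i j n h ≫ k := by
  rw [← Category.assoc, tι_gradedTens, Category.assoc]

/-- Degreewise splittings are not chain maps, so functoriality of the tensor product is needed for
maps of graded modules as well. -/
theorem gradedTens_comp {A B C : Cpx S} (V : Cpx S) (r : ∀ i, A.X i ⟶ B.X i)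
    (s : ∀ i, B.X i ⟶ C.X i) (n : ℤ) :
    gradedTens V r n ≫ gradedTens V s n = gradedTens V (fun i => r i ≫ s i) n :=
  tens_hom_ext fun i j h => by simp

theorem gradedTens_id (A V : Cpx S) (n : ℤ) :
    gradedTens V (fun i => 𝟙 (A.X i)) n = 𝟙 ((tens A V).X n) :=
  tens_hom_ext fun i j h => by simp

theorem gradedTens_add {A B : Cpx S} (V : Cpx S) (r s : ∀ i, A.X i ⟶ B.X i) (n : ℤ) :
    gradedTens V r n + gradedTens V s n = gradedTens V (fun i => r i + s i) n :=
  tens_hom_ext fun i j h => by simp [MonoidalPreadditive.add_whiskerRight]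

theorem tmap_f_eq {A B : Cpx S} (V : Cpx S) (f : A ⟶ B) (n : ℤ) :
    (tmap f (𝟙 V)).f n = gradedTens V f.f n :=
  tens_hom_ext fun i j h => by simp

/-- A degreewise splitting of a short complex of complexes. -/
structure DegSplit {R : Type u} [CommRing R] (T : ShortComplex (Cpx R)) where
  r : ∀ i, T.X₂.X i ⟶ T.X₁.X i
  s : ∀ i, T.X₃.X i ⟶ T.X₂.X i
  f_r : ∀ i, T.f.f i ≫ r i = 𝟙 _
  s_g : ∀ i, s i ≫ T.g.f i = 𝟙 _
  id : ∀ i, r i ≫ T.f.f i + T.g.f i ≫ s i = 𝟙 _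

/-- Unlike exactness, a degreewise splitting survives extension of scalars and tensoring with an
arbitrary complex; the long exact sequences used below come from such splittings. -/
theorem DegSplit.shortExact {R : Type u} [CommRing R] {T : ShortComplex (Cpx R)}
    (σ : DegSplit T) : T.ShortExact :=
  HomologicalComplex.shortExact_of_degreewise_shortExact T fun i =>
    ShortComplex.Splitting.shortExact ⟨σ.r i, σ.s i, σ.f_r i, σ.s_g i, σ.id i⟩

/-- Tensor products preserve degreewise splittings. -/
def DegSplit.tens {T : ShortComplex (Cpx S)} (σ : DegSplit T) (V : Cpx S) :
    DegSplit (T.map (tensorR V)) where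
  r := gradedTens V σ.r
  s := gradedTens V σ.s
  f_r n := by
    refine (congrArg (· ≫ gradedTens V σ.r n) (tmap_f_eq V T.f n)).trans ?_
    refine (gradedTens_comp V _ _ n).trans ?_
    simp_rw [σ.f_r]
    exact gradedTens_id _ V n
  s_g n := by
    refine (congrArg (gradedTens V σ.s n ≫ ·) (tmap_f_eq V T.g n)).trans ?_
    refine (gradedTens_comp V _ _ n).trans ?_
    simp_rw [σ.s_g]
    exact gradedTens_id _ V n
  id n := by
    refine (congrArg₂ (fun a b => gradedTens V σ.r n ≫ a + b ≫ gradedTens V σ.s n)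
      (tmap_f_eq V T.f n) (tmap_f_eq V T.g n)).trans ?_
    refine (congrArg₂ (· + ·) (gradedTens_comp V _ _ n) (gradedTens_comp V _ _ n)).trans ?_
    refine (gradedTens_add V _ _ n).trans ?_
    simp_rw [σ.id]
    exact gradedTens_id _ V n

/-- Tensor products preserve homotopies. -/
def tmapHomotopy {A A' : Cpx S} {f g : A ⟶ A'} (h : Homotopy f g) (V : Cpx S) :
    Homotopy (tmap f (𝟙 V)) (tmap g (𝟙 V)) :=
  HomologicalComplex.mapBifunctorMapHomotopy₁ h (𝟙 V) (curriedTensor _) (ComplexShape.up ℤ)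

/-- Tensor products of complexes are associative. -/
def tensAssoc (A B C : Cpx S) : tens (tens A B) C ≅ tens A (tens B C) :=
  HomologicalComplex.associator A B C

/-- The ring is a unit for tensor products of complexes. -/
def unitTens (A : Cpx S) :
    tens ((HomologicalComplex.single (ModuleCat.{u} S) (ComplexShape.up ℤ) 0).obj
      (ModuleCat.of S S)) A ≅ A :=
  HomologicalComplex.leftUnitor A

/-- Isomorphisms of complexes induce isomorphisms of tensor products. -/
def tensCongr {A A' B B' : Cpx S} (e : A ≅ A') (e' : B ≅ B') : tens A B ≅ tens A' B' where
  hom := tmap e.hom e'.hom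
  inv := tmap e.inv e'.inv
  hom_inv_id := tens_ext fun i j n h => by simp
  inv_hom_id := tens_ext fun i j n h => by simp

/-- Tensor products commute with shifts of the first factor. -/
def tensShift (A B : Cpx S) (n : ℤ) : tens (A⟦n⟧) B ≅ (tens A B)⟦n⟧ :=
  CochainComplex.mapBifunctorShift₁Iso A B (curriedTensor _) n

end TensorBasics

/-! ### Symmetry of the tensor product -/

section Braiding

variable {S : Type u} [CommRing S]

/-- The symmetry of the tensor product of complexes, with the Koszul sign. -/
def braidHom (A B : Cpx S) : tens A B ⟶ tens B A where
  f n := tdesc fun i j h => (i * j).negOnePow • (β_ (A.X i) (B.X j)).hom ≫ tι B A j i n (by lia)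
  comm' n n' hn := tens_hom_ext fun i j h => by
    have hn : n + 1 = n' := hn
    rw [tι_desc_assoc, Linear.units_smul_comp, Category.assoc,
      tι_d B A j i n (j + 1) (i + 1) n' (by lia) rfl rfl hn,
      tι_d_assoc A B i j n (i + 1) (j + 1) n' h rfl rfl hn]
    simp only [Preadditive.comp_add, Preadditive.add_comp, Linear.units_smul_comp,
      Linear.comp_units_smul, Category.assoc, tι_desc, smul_add, smul_smul,
      BraidedCategory.braiding_naturality_left_assoc,
      BraidedCategory.braiding_naturality_right_assoc]
    -- The swap exchanges the two halves of the differential. The signs agree because `ij + j = (i +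
    -- 1)j` and because `ij` and `i + i(j + 1)` have the same parity.
    rw [add_comm]
    congr 2
    · rw [← Int.negOnePow_add]
      rw [add_mul, one_mul]
    · rw [← Int.negOnePow_add]
      rw [Int.negOnePow_eq_iff]
      exact ⟨-i, by ring⟩

theorem braidHom_comp (A B : Cpx S) : braidHom A B ≫ braidHom B A = 𝟙 _ :=
  tens_ext fun i j n h => by
    simp only [braidHom, HomologicalComplex.comp_f, tι_desc_assoc, Linear.units_smul_comp,
      Category.assoc, tι_desc, Linear.comp_units_smul, smul_smul, SymmetricCategory.symmetry_assoc]
    rw [← Int.negOnePow_add, mul_comm j i, Int.negOnePow_even _ ⟨_, rfl⟩, one_smul]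
    exact (Category.comp_id _).symm

/-- Tensor products of complexes are commutative. -/
def tensComm (A B : Cpx S) : tens A B ≅ tens B A where
  hom := braidHom A B
  inv := braidHom B A
  hom_inv_id := braidHom_comp A B
  inv_hom_id := braidHom_comp B A

end Braiding

/-! ### Extension of scalars of complexes -/

section ExtendScalars

variable {R S T : Type u} [CommRing R] [CommRing S] [CommRing T] (φ : R →+* S)

/-- Extension of scalars for complexes. -/
abbrev extC : Cpx R ⥤ Cpx S :=
  (ModuleCat.extendScalars.{u, u, u} φ).mapHomologicalComplex (ComplexShape.up ℤ)

/-- Extension of scalars preserves degreewise splittings. -/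
def DegSplit.extC {T : ShortComplex (Cpx R)} (σ : DegSplit T) :
    DegSplit (T.map (extC φ)) where
  r i := (ModuleCat.extendScalars φ).map (σ.r i)
  s i := (ModuleCat.extendScalars φ).map (σ.s i)
  f_r i := by
    refine ((ModuleCat.extendScalars φ).map_comp _ _).symm.trans ?_
    rw [σ.f_r]
    exact (ModuleCat.extendScalars φ).map_id _
  s_g i := by
    refine ((ModuleCat.extendScalars φ).map_comp _ _).symm.trans ?_
    rw [σ.s_g]
    exact (ModuleCat.extendScalars φ).map_id _
  id i := by
    refine (congrArg₂ (· + ·) ((ModuleCat.extendScalars φ).map_comp _ _).symm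
      ((ModuleCat.extendScalars φ).map_comp _ _).symm).trans ?_
    refine (ModuleCat.extendScalars φ).map_add.symm.trans ?_
    rw [σ.id]
    exact (ModuleCat.extendScalars φ).map_id _

/-- Iterated extension of scalars. -/
def extCComp (ψ : S →+* T) (A : Cpx R) : (extC (ψ.comp φ)).obj A ≅ (extC ψ).obj ((extC φ).obj A) :=
  (NatIso.mapHomologicalComplex (ModuleCat.extendScalarsComp φ ψ) (ComplexShape.up ℤ)).app A

/-- The image under extension of scalars of the inclusion of a summand. -/
def extι (A B : Cpx R) (i j n : ℤ) (h : i + j = n) :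
    (ModuleCat.extendScalars φ).obj (A.X i ⊗ B.X j) ⟶ ((extC φ).obj (tens A B)).X n :=
  (ModuleCat.extendScalars φ).map (tι A B i j n h)

theorem extι_d (A B : Cpx R) (i j n i' j' n' : ℤ) (h : i + j = n) (hi : i + 1 = i')
    (hj : j + 1 = j') (hn : n + 1 = n') :
    extι φ A B i j n h ≫ ((extC φ).obj (tens A B)).d n n' =
      (ModuleCat.extendScalars φ).map (A.d i i' ▷ B.X j) ≫ extι φ A B i' j n' (by lia)
        + i.negOnePow • (ModuleCat.extendScalars φ).map (A.X i ◁ B.d j j') ≫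
          extι φ A B i j' n' (by lia) := by
  refine ((ModuleCat.extendScalars φ).map_comp _ _).symm.trans ?_
  rw [tι_d A B i j n i' j' n' h hi hj hn, Functor.map_add, Functor.map_units_smul,
    Functor.map_comp, Functor.map_comp]
  rfl

-- Extension of scalars is a left adjoint, so the universal property of the direct sum carries over
-- through adjuncts.
variable {φ} in
theorem ext_tens_hom_ext {A B : Cpx R} {n : ℤ} {Z : ModuleCat.{u} S}
    {f g : ((extC φ).obj (tens A B)).X n ⟶ Z}
    (h : ∀ i j (h : i + j = n), extι φ A B i j n h ≫ f = extι φ A B i j n h ≫ g) : f = g :=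
  ((ModuleCat.extendRestrictScalarsAdj φ).homEquiv ((tens A B).X n) Z).injective
    (tens_hom_ext fun i j hij =>
      ((Adjunction.homEquiv_naturality_left _ _ _).symm.trans
        (congrArg ((ModuleCat.extendRestrictScalarsAdj φ).homEquiv _ _) (h i j hij))).trans
        (Adjunction.homEquiv_naturality_left _ _ _))

variable {φ} in
/-- Maps out of the extension of scalars of a tensor product. -/
def extTensDesc {A B : Cpx R} {n : ℤ} {Z : ModuleCat.{u} S}
    (f : ∀ i j (_ : i + j = n), (ModuleCat.extendScalars.{u, u, u} φ).obj (A.X i ⊗ B.X j) ⟶ Z) :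
    ((extC φ).obj (tens A B)).X n ⟶ Z :=
  ((ModuleCat.extendRestrictScalarsAdj φ).homEquiv ((tens A B).X n) Z).symm
    (tdesc fun i j h => (ModuleCat.extendRestrictScalarsAdj φ).homEquiv _ _ (f i j h))

@[simp]
theorem extι_extTensDesc {A B : Cpx R} {n : ℤ} {Z : ModuleCat.{u} S}
    (f : ∀ i j (_ : i + j = n), (ModuleCat.extendScalars.{u, u, u} φ).obj (A.X i ⊗ B.X j) ⟶ Z)
    (i j : ℤ) (h : i + j = n) :
    extι φ A B i j n h ≫ extTensDesc f = f i j h := by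
  refine (Adjunction.homEquiv_naturality_left_symm _ _ _).symm.trans ?_
  rw [tι_desc, Equiv.symm_apply_apply]

@[simp]
theorem extι_extTensDesc_assoc {A B : Cpx R} {n : ℤ} {Z Z' : ModuleCat.{u} S}
    (f : ∀ i j (_ : i + j = n), (ModuleCat.extendScalars.{u, u, u} φ).obj (A.X i ⊗ B.X j) ⟶ Z)
    (i j : ℤ) (h : i + j = n) (k : Z ⟶ Z') :
    extι φ A B i j n h ≫ extTensDesc f ≫ k = f i j h ≫ k := by
  rw [← Category.assoc, extι_extTensDesc]

/-- Extension of scalars commutes with tensor products of modules. -/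
def extμ (A B : Cpx R) (i j : ℤ) : ((extC φ).obj A).X i ⊗ ((extC φ).obj B).X j ≅
    (ModuleCat.extendScalars φ).obj (A.X i ⊗ B.X j) :=
  Functor.Monoidal.μIso (ModuleCat.extendScalars φ) (A.X i) (B.X j)

theorem extμ_left (A B : Cpx R) (i i' j : ℤ) :
    (((extC φ).obj A).d i i' ▷ ((extC φ).obj B).X j) ≫ (extμ φ A B i' j).hom =
      (extμ φ A B i j).hom ≫ (ModuleCat.extendScalars φ).map (A.d i i' ▷ B.X j) :=
  Functor.LaxMonoidal.μ_natural_left (ModuleCat.extendScalars φ) (A.d i i') (B.X j)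

theorem extμ_left_assoc (A B : Cpx R) (i i' j : ℤ) {Z : ModuleCat.{u} S}
    (k : (ModuleCat.extendScalars φ).obj (A.X i' ⊗ B.X j) ⟶ Z) :
    (((extC φ).obj A).d i i' ▷ ((extC φ).obj B).X j) ≫ (extμ φ A B i' j).hom ≫ k =
      (extμ φ A B i j).hom ≫ (ModuleCat.extendScalars φ).map (A.d i i' ▷ B.X j) ≫ k := by
  rw [← Category.assoc, extμ_left, Category.assoc]

theorem extμ_right (A B : Cpx R) (i j j' : ℤ) :
    (((extC φ).obj A).X i ◁ ((extC φ).obj B).d j j') ≫ (extμ φ A B i j').hom =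
      (extμ φ A B i j).hom ≫ (ModuleCat.extendScalars φ).map (A.X i ◁ B.d j j') :=
  Functor.LaxMonoidal.μ_natural_right (ModuleCat.extendScalars φ) (A.X i) (B.d j j')

theorem extμ_right_assoc (A B : Cpx R) (i j j' : ℤ) {Z : ModuleCat.{u} S}
    (k : (ModuleCat.extendScalars φ).obj (A.X i ⊗ B.X j') ⟶ Z) :
    (((extC φ).obj A).X i ◁ ((extC φ).obj B).d j j') ≫ (extμ φ A B i j').hom ≫ k =
      (extμ φ A B i j).hom ≫ (ModuleCat.extendScalars φ).map (A.X i ◁ B.d j j') ≫ k := by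
  rw [← Category.assoc, extμ_right, Category.assoc]

/-- The comparison of tensor products with extensions of scalars. -/
def extTensHom (A B : Cpx R) :
    tens ((extC φ).obj A) ((extC φ).obj B) ⟶ (extC φ).obj (tens A B) where
  f n := tdesc fun i j h => (extμ φ A B i j).hom ≫ extι φ A B i j n h
  comm' n n' hn := tens_hom_ext fun i j h => by
    have hn : n + 1 = n' := hn
    rw [tι_desc_assoc, tι_d_assoc _ _ i j n (i + 1) (j + 1) n' h rfl rfl hn,
      Category.assoc, extι_d φ _ _ i j n (i + 1) (j + 1) n' h rfl rfl hn]
    simp only [Preadditive.add_comp, Category.assoc, Linear.units_smul_comp, tι_desc,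
      Preadditive.comp_add, Linear.comp_units_smul, extμ_left_assoc, extμ_right_assoc]

/-- Extension of scalars commutes with tensor products of complexes. -/
def extTens (A B : Cpx R) :
    tens ((extC φ).obj A) ((extC φ).obj B) ≅ (extC φ).obj (tens A B) :=
  HomologicalComplex.Hom.isoOfComponents
    (fun n =>
      { hom := (extTensHom φ A B).f n
        inv := extTensDesc fun i j h => (extμ φ A B i j).inv ≫
          tι ((extC φ).obj A) ((extC φ).obj B) i j n h
        hom_inv_id := tens_hom_ext fun i j h => by
          rw [extTensHom, tι_desc_assoc, Category.assoc, extι_extTensDesc,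
            Iso.hom_inv_id_assoc, Category.comp_id]
        inv_hom_id := ext_tens_hom_ext fun i j h => by
          rw [extTensHom, extι_extTensDesc_assoc, Category.assoc, tι_desc,
            Iso.inv_hom_id_assoc, Category.comp_id] })
    (fun i j _ => (extTensHom φ A B).comm i j)

end ExtendScalars

/-! ### Length and finiteness in exact sequences of modules -/

section Modules

variable {S : Type u} [CommRing S]

theorem length_eq_of_iso {M N : ModuleCat.{u} S} (e : M ≅ N) :
    Module.length S M = Module.length S N :=
  e.toLinearEquiv.length_eq

theorem finite_of_iso {M N : ModuleCat.{u} S} (e : M ≅ N) (h : Module.Finite S M) :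
    Module.Finite S N :=
  Module.Finite.equiv e.toLinearEquiv

theorem length_le_of_exact {T : ShortComplex (ModuleCat.{u} S)} (hT : T.Exact) :
    Module.length S T.X₂ ≤ Module.length S T.X₁ + Module.length S T.X₃ := by
  have h1 := Module.length_eq_add_of_exact (LinearMap.ker T.g.hom).subtype T.g.hom.rangeRestrict
    (Submodule.subtype_injective _) T.g.hom.surjective_rangeRestrict
    (fun x => by simp [← Subtype.coe_inj])
  rw [h1]
  refine add_le_add ?_ (Module.length_le_of_injective _ (Submodule.subtype_injective _))
  rw [← hT.moduleCat_range_eq_ker]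
  exact Module.length_le_of_surjective _ T.f.hom.surjective_rangeRestrict

theorem length_eq_of_shortExact {T : ShortComplex (ModuleCat.{u} S)} (hT : T.ShortExact) :
    Module.length S T.X₂ = Module.length S T.X₁ + Module.length S T.X₃ :=
  Module.length_eq_add_of_exact T.f.hom T.g.hom hT.moduleCat_injective_f
    hT.moduleCat_surjective_g ((ShortComplex.ShortExact.moduleCat_exact_iff_function_exact T).1 hT.exact)

theorem finite_of_exact [IsNoetherianRing S] {T : ShortComplex (ModuleCat.{u} S)} (hT : T.Exact)
    (h1 : Module.Finite S T.X₁) (h3 : Module.Finite S T.X₃) : Module.Finite S T.X₂ := by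
  have : Module.Finite S (LinearMap.ker T.g.hom) := by
    rw [← hT.moduleCat_range_eq_ker]
    infer_instance
  have : Module.Finite S (LinearMap.range T.g.hom) := inferInstance
  have : Module.Finite S (T.X₂ ⧸ LinearMap.ker T.g.hom) :=
    Module.Finite.equiv (LinearMap.quotKerEquivRange T.g.hom).symm
  exact Module.Finite.of_submodule_quotient (LinearMap.ker T.g.hom)

end Modules

/-! ### Mapping cones and their long exact sequences -/

section Functor

variable {R S : Type u} [CommRing R] [CommRing S] (φ : R →+* S)

/-- The functor `X ↦ (S ⊗_R X) ⊗_S V`. -/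
abbrev tfun (V : Cpx S) : Cpx R ⥤ Cpx S := extC φ ⋙ tensorR V

/-- The functor `X ↦ (S ⊗_R X) ⊗_S V` preserves degreewise splittings. -/
def DegSplit.tfun {T : ShortComplex (Cpx R)} (σ : DegSplit T) (V : Cpx S) :
    DegSplit (T.map (tfun φ V)) :=
  (σ.extC φ).tens V

/-- The functor `X ↦ (S ⊗_R X) ⊗_S V` preserves homotopies. -/
def tfunHomotopy {X Y : Cpx R} {f g : X ⟶ Y} (h : Homotopy f g) (V : Cpx S) :
    Homotopy ((tfun φ V).map f) ((tfun φ V).map g) :=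
  tmapHomotopy ((ModuleCat.extendScalars.{u, u, u} φ).mapHomotopy h) V

/-- The functor `X ↦ (S ⊗_R X) ⊗_S V` commutes with shifts. -/
def tfunShift (X : Cpx R) (V : Cpx S) (n : ℤ) :
    tensor φ (X⟦n⟧) V ≅ (tensor φ X V)⟦n⟧ :=
  tensCongr (((extC φ).commShiftIso n).app X) (Iso.refl V) ≪≫ tensShift _ _ n

/-- The cohomology of a shifted complex. -/
def homologyShift (X : Cpx R) (n i j : ℤ) (h : n + i = j) :
    (X⟦n⟧).homology i ≅ X.homology j :=
  ((HomologicalComplex.homologyFunctor (ModuleCat.{u} R) (ComplexShape.up ℤ) 0).shiftIso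
    n i j h).app X

/-- The short complex `Z ⟶ cone f ⟶ X[1]`. -/
def coneSeq {X Z : Cpx R} (f : X ⟶ Z) : ShortComplex (Cpx R) where
  X₁ := Z
  X₂ := CochainComplex.mappingCone f
  X₃ := X⟦(1 : ℤ)⟧
  f := (CochainComplex.mappingCone.triangleRotateShortComplex f).f
  g := (CochainComplex.mappingCone.triangleRotateShortComplex f).g
  zero := (CochainComplex.mappingCone.triangleRotateShortComplex f).zero

/-- The mapping cone sequence is degreewise split. -/
def coneSeqSplit {X Z : Cpx R} (f : X ⟶ Z) : DegSplit (coneSeq f) where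
  r i := (CochainComplex.mappingCone.triangleRotateShortComplexSplitting f i).r
  s i := (CochainComplex.mappingCone.triangleRotateShortComplexSplitting f i).s
  f_r i := (CochainComplex.mappingCone.triangleRotateShortComplexSplitting f i).f_r
  s_g i := (CochainComplex.mappingCone.triangleRotateShortComplexSplitting f i).s_g
  id i := (CochainComplex.mappingCone.triangleRotateShortComplexSplitting f i).id

theorem homologyMap_comp_inr {X Z : Cpx R} (f : X ⟶ Z) (i : ℤ) :
    HomologicalComplex.homologyMap f i ≫
      HomologicalComplex.homologyMap (CochainComplex.mappingCone.inr f) i = 0 := by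
  rw [← HomologicalComplex.homologyMap_comp]
  have h : Homotopy (f ≫ CochainComplex.mappingCone.inr f) 0 :=
    HomologicalComplex.homotopyCofiber.inrCompHomotopy f (fun j => ⟨j - 1, by simp⟩)
  rw [h.homologyMap_eq, HomologicalComplex.homologyMap_zero]

/-- There is an exact sequence `A ⟶ B ⟶ C`. -/
def Ex (A B C : ModuleCat.{u} R) : Prop :=
  ∃ (f : A ⟶ B) (g : B ⟶ C) (w : f ≫ g = 0), (ShortComplex.mk f g w).Exact

theorem Ex.congr {A B C A' B' C' : ModuleCat.{u} R} (h : Ex A B C) (a : A ≅ A') (b : B ≅ B')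
    (c : C ≅ C') : Ex A' B' C' := by
  obtain ⟨f, g, w, h⟩ := h
  refine ⟨a.inv ≫ f ≫ b.hom, b.inv ≫ g ≫ c.hom, by simp [reassoc_of% w], ?_⟩
  refine (ShortComplex.exact_iff_of_iso ?_).1 h
  exact ShortComplex.isoMk a b c (by simp) (by simp)

theorem Ex.length_le {A B C : ModuleCat.{u} R} (h : Ex A B C) :
    Module.length R B ≤ Module.length R A + Module.length R C := by
  obtain ⟨f, g, w, h⟩ := h
  exact length_le_of_exact h

theorem Ex.finite [IsNoetherianRing R] {A B C : ModuleCat.{u} R} (h : Ex A B C)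
    (hA : Module.Finite R A) (hC : Module.Finite R C) : Module.Finite R B := by
  obtain ⟨f, g, w, h⟩ := h
  exact finite_of_exact h hA hC

theorem Ex.isZero {A B C : ModuleCat.{u} R} (h : Ex A B C) (hA : IsZero A) (hC : IsZero C) :
    IsZero B := by
  obtain ⟨f, g, w, h⟩ := h
  exact h.isZero_of_both_zeros (hA.eq_of_src _ _) (hC.eq_of_tgt _ _)

section

variable {T : ShortComplex (Cpx R)} (hT : T.ShortExact)

include hT

theorem ex₁ (i j : ℤ) (h : i + 1 = j) :
    Ex (T.X₃.homology i) (T.X₁.homology j) (T.X₂.homology j) :=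
  ⟨_, _, _, hT.homology_exact₁ i j h⟩

theorem ex₂ (i : ℤ) : Ex (T.X₁.homology i) (T.X₂.homology i) (T.X₃.homology i) :=
  ⟨_, _, _, hT.homology_exact₂ i⟩

theorem ex₃ (i j : ℤ) (h : i + 1 = j) :
    Ex (T.X₂.homology i) (T.X₃.homology i) (T.X₁.homology j) :=
  ⟨_, _, _, hT.homology_exact₃ i j h⟩

end

open CochainComplex (mappingCone)

theorem cone_ex₂ {X Z : Cpx R} (f : X ⟶ Z) (i j : ℤ) (h : i + 1 = j) :
    Ex (Z.homology i) ((mappingCone f).homology i) (X.homology j) :=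
  (ex₂ (coneSeqSplit f).shortExact i).congr (Iso.refl _) (Iso.refl _)
    (homologyShift X 1 i j (by lia))

theorem cone_ex₃ {X Z : Cpx R} (f : X ⟶ Z) (i j : ℤ) (h : i + 1 = j) :
    Ex ((mappingCone f).homology i) (X.homology j) (Z.homology j) :=
  (ex₃ (coneSeqSplit f).shortExact i j h).congr (Iso.refl _)
    (homologyShift X 1 i j (by lia)) (Iso.refl _)

/-- The composite `H^i(X) → H^i(Z) → H^i(cone)` is zero; as its first map is surjective, the second
one vanishes. The other neighbour of `H^i(cone)` is `H^j(X) = 0`. -/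
theorem cone_isZero_of_epi {X Z : Cpx R} (f : X ⟶ Z) (i j : ℤ) (h : i + 1 = j)
    (hf : Epi (HomologicalComplex.homologyMap f i)) (hX : IsZero (X.homology j)) :
    IsZero ((mappingCone f).homology i) := by
  have h2 := (coneSeqSplit f).shortExact.homology_exact₂ i
  refine h2.isZero_of_both_zeros ?_ (IsZero.eq_of_tgt
    (IsZero.of_iso hX (homologyShift X 1 i j (by lia))) _ _)
  have := homologyMap_comp_inr f i
  exact (cancel_epi (HomologicalComplex.homologyMap f i)).1 (this.trans comp_zero.symm)

/-- The two hypotheses cut the long exact sequence down to `0 → H^i(cone) → H^j(X) → H^j(Z) → 0`. -/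
theorem cone_length_of_epi {X Z : Cpx R} (f : X ⟶ Z) (i j : ℤ) (h : i + 1 = j)
    (hf : Epi (HomologicalComplex.homologyMap f j)) (hZ : IsZero (Z.homology i)) :
    Module.length R (X.homology j) =
      Module.length R ((mappingCone f).homology i) + Module.length R (Z.homology j) := by
  have hS := (coneSeqSplit f).shortExact
  have h0 : HomologicalComplex.homologyMap (coneSeq f).f j = 0 :=
    (cancel_epi (HomologicalComplex.homologyMap f j)).1
      ((homologyMap_comp_inr f j).trans comp_zero.symm)
  have h1 : Epi (hS.δ i j h) := (hS.homology_exact₁ i j h).epi_f h0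
  have h2 : Mono (HomologicalComplex.homologyMap (coneSeq f).g i) :=
    (hS.homology_exact₂ i).mono_g (IsZero.eq_of_src hZ _ _)
  have h3 := length_eq_of_shortExact (T := ShortComplex.mk _ _ (hS.comp_δ i j h))
    ⟨hS.homology_exact₃ i j h⟩
  rw [length_eq_of_iso (homologyShift X 1 i j (by lia)).symm]
  exact h3

variable (V : Cpx S)

/-- The cone sequence is degreewise split, so it stays exact after tensoring and no flatness of `V`
is required. -/
theorem cone_tensor_ex₁ {X Z : Cpx R} (f : X ⟶ Z) (i : ℤ) :
    Ex ((tensor φ X V).homology i) ((tensor φ Z V).homology i)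
      ((tensor φ (mappingCone f) V).homology i) :=
  (ex₁ ((coneSeqSplit f).tfun φ V).shortExact (i - 1) i (by lia)).congr
    ((HomologicalComplex.homologyFunctor _ _ _).mapIso (tfunShift φ X V 1) ≪≫
      homologyShift (tensor φ X V) 1 (i - 1) i (by lia)) (Iso.refl _) (Iso.refl _)

theorem cone_tensor_ex₃ {X Z : Cpx R} (f : X ⟶ Z) (i j : ℤ) (h : i + 1 = j) :
    Ex ((tensor φ (mappingCone f) V).homology i) ((tensor φ X V).homology j)
      ((tensor φ Z V).homology j) :=
  (ex₃ ((coneSeqSplit f).tfun φ V).shortExact i j h).congr (Iso.refl _)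
    ((HomologicalComplex.homologyFunctor _ _ _).mapIso (tfunShift φ X V 1) ≪≫
      homologyShift (tensor φ X V) 1 i j (by lia)) (Iso.refl _)

theorem length_eq_of_ex {A B C D : ModuleCat.{u} R} (h : Ex A B C) (h' : Ex B C D) (hA : IsZero A)
    (hD : IsZero D) : Module.length R B = Module.length R C := by
  have := ModuleCat.subsingleton_of_isZero hA
  have := ModuleCat.subsingleton_of_isZero hD
  exact le_antisymm (by simpa [Module.length_eq_zero] using h.length_le)
    (by simpa [Module.length_eq_zero] using h'.length_le)

/-- Extension of scalars along the identity. -/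
def tensorId (X V : Cpx R) : tensor (RingHom.id R) X V ≅ tens X V :=
  tensCongr ((NatIso.mapHomologicalComplex (ModuleCat.extendScalarsId R)
    (ComplexShape.up ℤ)).app X ≪≫ (Functor.mapHomologicalComplexIdIso _ _).app X) (Iso.refl V)

end Functor

/-! ### Elements acting null-homotopically -/

section NullIdeal

variable {R S : Type u} [CommRing R] [CommRing S] (φ : R →+* S)

/-- The ideal of all `s` whose action on `W` is homotopic to zero. -/
def nullIdeal (W : Cpx S) : Ideal S where
  carrier := {s | Nonempty (Homotopy (s • 𝟙 W) 0)}
  add_mem' := by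
    rintro a b ⟨ha⟩ ⟨hb⟩
    exact ⟨(Homotopy.ofEq (add_smul a b _)).trans ((ha.add hb).trans (Homotopy.ofEq (add_zero 0)))⟩
  zero_mem' := ⟨Homotopy.ofEq (zero_smul _ _)⟩
  smul_mem' := by
    rintro c a ⟨ha⟩
    exact ⟨(Homotopy.ofEq (by rw [smul_eq_mul, mul_smul])).trans
      ((ha.smul c).trans (Homotopy.ofEq (smul_zero c)))⟩

theorem nullIdeal_le_of_iso {A B : Cpx S} (e : A ≅ B) : nullIdeal A ≤ nullIdeal B := by
  rintro s ⟨h⟩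
  exact ⟨(Homotopy.ofEq (by simp)).trans (((h.compLeft e.inv).compRight e.hom).trans
    (Homotopy.ofEq (by simp)))⟩

theorem smul_tmap {A B : Cpx S} (V : Cpx S) (s : S) (f : A ⟶ B) :
    tmap (s • f) (𝟙 V) = s • tmap f (𝟙 V) := tens_ext fun i j n h => by
  rw [HomologicalComplex.smul_f_apply, Linear.comp_smul, tι_map, tι_map]
  simp [MonoidalLinear.smul_whiskerRight]

theorem nullIdeal_le_tens_left (A V : Cpx S) : nullIdeal A ≤ nullIdeal (tens A V) := by
  rintro s ⟨h⟩
  refine ⟨(Homotopy.ofEq ?_).trans ((tmapHomotopy h V).trans (Homotopy.ofEq ?_))⟩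
  · rw [smul_tmap]
    congr 1
    exact ((tensorR V).map_id A).symm
  · exact (tensorR V).map_zero _ _

theorem nullIdeal_le_tens_right (V A : Cpx S) : nullIdeal A ≤ nullIdeal (tens V A) :=
  (nullIdeal_le_tens_left A V).trans (nullIdeal_le_of_iso (tensComm A V))

theorem extendScalars_map_smul (r : R) {M N : ModuleCat.{u} R} (f : M ⟶ N) :
    (ModuleCat.extendScalars.{u, u, u} φ).map (r • f) =
      φ r • (ModuleCat.extendScalars.{u, u, u} φ).map f := by
  let := φ.toAlgebra
  refine ModuleCat.ExtendScalars.hom_ext fun m => ?_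
  exact TensorProduct.tmul_smul r (1 : S) (f m) |>.trans
    ((TensorProduct.smul_tmul' r (1 : S) (f m)).trans (by
      rw [Algebra.smul_def]
      exact (TensorProduct.smul_tmul' (φ r) (1 : S) (f m)).symm))

theorem map_nullIdeal_le_extC (X : Cpx R) :
    (nullIdeal X).map φ ≤ nullIdeal ((extC φ).obj X) := by
  rw [Ideal.map_le_iff_le_comap]
  rintro r ⟨h⟩
  refine ⟨(Homotopy.ofEq ?_).trans (((ModuleCat.extendScalars.{u, u, u} φ).mapHomotopy h).trans
    (Homotopy.ofEq ((extC φ).map_zero _ _)))⟩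
  ext n : 1
  refine Eq.trans ?_ (extendScalars_map_smul φ r ((𝟙 X : X ⟶ X).f n)).symm
  exact congrArg (φ r • ·) ((ModuleCat.extendScalars.{u, u, u} φ).map_id (X.X n)).symm

theorem homologyMap_smul_id (W : Cpx S) (s : S) (i : ℤ) :
    HomologicalComplex.homologyMap (s • 𝟙 W) i = s • 𝟙 (W.homology i) := by
  refine (ShortComplex.homologyMap_smul
    ((HomologicalComplex.shortComplexFunctor _ _ i).map (𝟙 W)) s).trans ?_
  exact congrArg (s • ·) (HomologicalComplex.homologyMap_id W i)

theorem smul_homology_eq_zero {W : Cpx S} {s : S} (hs : s ∈ nullIdeal W) (i : ℤ)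
    (x : W.homology i) : s • x = 0 := by
  obtain ⟨h⟩ := hs
  have h1 := homologyMap_smul_id W s i
  rw [h.homologyMap_eq, HomologicalComplex.homologyMap_zero] at h1
  exact (ConcreteCategory.congr_hom h1 x).symm

end NullIdeal

/-! ### Vanishing for tensor products with bounded complexes of projectives -/

section Flat

variable {S : Type u} [CommRing S] (A Y : Cpx S)

theorem exact_iff_homology (W : Cpx S) (i j k : ℤ) (hi : i + 1 = j) (hj : j + 1 = k) :
    IsZero (W.homology j) ↔
      ∀ z : W.X j, W.d j k z = 0 → ∃ w : W.X i, W.d i j w = z := by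
  rw [← HomologicalComplex.exactAt_iff_isZero_homology,
    HomologicalComplex.exactAt_iff' W i j k (by simp [← hi]) (by simp [hj]),
    ShortComplex.moduleCat_exact_iff]
  rfl

/-- The part of `(A ⊗ Y)^n` coming from the summands `A^i ⊗ Y^j` with `p ≤ i`. -/
def tensFil (p n : ℤ) : Submodule S ((tens A Y).X n) :=
  ⨆ (x : {x : ℤ × ℤ // x.1 + x.2 = n ∧ p ≤ x.1}),
    LinearMap.range (tι A Y x.1.1 x.1.2 n x.2.1).hom

variable {A Y}

theorem tι_mem_tensFil {p n : ℤ} (i j : ℤ) (h : i + j = n) (hp : p ≤ i)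
    (x : (A.X i ⊗ Y.X j : ModuleCat.{u} S)) : tι A Y i j n h x ∈ tensFil A Y p n :=
  (le_iSup (fun x : {x : ℤ × ℤ // x.1 + x.2 = n ∧ p ≤ x.1} =>
    LinearMap.range (tι A Y x.1.1 x.1.2 n x.2.1).hom) ⟨(i, j), h, hp⟩) ⟨x, rfl⟩

theorem tensFil_le {p n : ℤ} {N : Submodule S ((tens A Y).X n)}
    (h : ∀ i j (h : i + j = n) (_ : p ≤ i) (x : (A.X i ⊗ Y.X j : ModuleCat.{u} S)),
      tι A Y i j n h x ∈ N) : tensFil A Y p n ≤ N :=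
  iSup_le fun x => by
    rintro _ ⟨y, rfl⟩
    exact h _ _ x.2.1 x.2.2 y

theorem tensFil_anti {p q n : ℤ} (h : p ≤ q) : tensFil A Y q n ≤ tensFil A Y p n :=
  tensFil_le fun i j hij hq x => tι_mem_tensFil i j hij (h.trans hq) x

/-- The filtration is exhaustive: the quotient map by its union kills every summand, hence is zero.
-/
theorem exists_mem_tensFil {n : ℤ} (z : (tens A Y).X n) : ∃ p, z ∈ tensFil A Y p n := by
  have hdir : Directed (· ≤ ·) fun p : ℤ => tensFil A Y p n := fun p q =>
    ⟨min p q, tensFil_anti (min_le_left _ _), tensFil_anti (min_le_right _ _)⟩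
  rw [← Submodule.mem_iSup_of_directed _ hdir]
  have h : ModuleCat.ofHom (⨆ p, tensFil A Y p n).mkQ = 0 := tens_hom_ext fun i j hij => by
    ext x
    refine (Submodule.Quotient.mk_eq_zero _).2 ?_
    exact (le_iSup (fun p : ℤ => tensFil A Y p n) i) (tι_mem_tensFil i j hij le_rfl x)
  exact (Submodule.Quotient.mk_eq_zero _).1 (ConcreteCategory.congr_hom h z)

theorem tensFil_eq_bot {p n : ℤ} (h : ∀ i, p ≤ i → IsZero (A.X i)) : tensFil A Y p n = ⊥ :=
  le_bot_iff.1 (tensFil_le fun i j hij hp x => by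
    have h0 : tι A Y i j n hij = 0 := IsZero.eq_of_src
      (by
        rw [IsZero.iff_id_eq_zero, ← MonoidalCategory.id_whiskerRight,
          (IsZero.iff_id_eq_zero _).1 (h i hp), MonoidalPreadditive.zero_whiskerRight]) _ _
    rw [h0]
    rfl)

theorem d_mem_tensFil {p n n' : ℤ} (hn : n + 1 = n') {z : (tens A Y).X n}
    (hz : z ∈ tensFil A Y p n) : (tens A Y).d n n' z ∈ tensFil A Y p n' := by
  suffices h : tensFil A Y p n ≤ (tensFil A Y p n').comap ((tens A Y).d n n').hom from h hz
  refine tensFil_le fun i j h hp x => ?_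
  have h1 := ConcreteCategory.congr_hom (tι_d A Y i j n (i + 1) (j + 1) n' h rfl rfl hn) x
  refine (Submodule.mem_comap).2 ?_
  refine (congrArg (· ∈ tensFil A Y p n') h1).mpr (Submodule.add_mem _ ?_ ?_)
  · exact tι_mem_tensFil (i + 1) j (by lia) (by lia) ((A.d i (i + 1) ▷ Y.X j) x)
  · rcases Int.units_eq_one_or i.negOnePow with e | e
    · rw [e, one_smul]
      exact tι_mem_tensFil i (j + 1) (by lia) (by lia) ((A.X i ◁ Y.d j (j + 1)) x)
    · rw [e, Units.neg_smul, one_smul]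
      exact Submodule.neg_mem _
        (tι_mem_tensFil i (j + 1) (by lia) (by lia) ((A.X i ◁ Y.d j (j + 1)) x))

/-- Modulo the next step of the filtration the differential is `± 1 ⊗ d`. The sign is recorded as a
scalar with square `1`, so that it can be cancelled by a second multiplication. -/
theorem d_tι_apply (p q n q' n' : ℤ) (h : p + q = n) (hq : q + 1 = q') (hn : n + 1 = n')
    (a : (A.X p ⊗ Y.X q : ModuleCat.{u} S)) :
    ∃ ε : S, ε * ε = 1 ∧ ∃ y ∈ tensFil A Y (p + 1) n',
      (tens A Y).d n n' (tι A Y p q n h a) =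
        y + ε • tι A Y p q' n' (by lia) ((A.X p ◁ Y.d q q') a) := by
  have e := ConcreteCategory.congr_hom (tι_d A Y p q n (p + 1) q' n' h rfl hq hn) a
  have hy := tι_mem_tensFil (p := p + 1) (n := n') (p + 1) q (by lia) le_rfl
    ((A.d p (p + 1) ▷ Y.X q) a)
  rcases Int.units_eq_one_or p.negOnePow with he | he
  · rw [he, one_smul] at e
    exact ⟨1, one_mul 1, _, hy, e.trans (by rw [one_smul]; rfl)⟩
  · rw [he, Units.neg_smul, one_smul] at e
    exact ⟨-1, by ring, _, hy, e.trans (by rw [neg_smul, one_smul]; rfl)⟩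

theorem tensFil_le_sup {p q n : ℤ} (h : p + q = n) :
    tensFil A Y p n ≤ LinearMap.range (tι A Y p q n h).hom ⊔ tensFil A Y (p + 1) n :=
  tensFil_le fun i j hij hp x => by
    rcases hp.eq_or_lt with rfl | hlt
    · obtain rfl : j = q := by lia
      exact Submodule.mem_sup_left ⟨x, rfl⟩
    · exact Submodule.mem_sup_right (tι_mem_tensFil i j hij (by lia) x)

variable (A Y) in
/-- The projection of `(A ⊗ Y)^n` onto a summand. -/
def tproj (p q n : ℤ) (h : p + q = n) : (tens A Y).X n ⟶ A.X p ⊗ Y.X q :=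
  tdesc fun i j h' => if hi : i = p then eqToHom (by
    obtain rfl := hi
    obtain rfl : j = q := by lia
    rfl) else 0

theorem tι_tproj (p q n : ℤ) (h : p + q = n) : tι A Y p q n h ≫ tproj A Y p q n h = 𝟙 _ := by
  simp [tproj]

theorem tproj_eq_zero {p q n : ℤ} (h : p + q = n) {z : (tens A Y).X n}
    (hz : z ∈ tensFil A Y (p + 1) n) : tproj A Y p q n h z = 0 := by
  suffices h : tensFil A Y (p + 1) n ≤ LinearMap.ker (tproj A Y p q n h).hom from h hz
  refine tensFil_le fun i j h' hp x => ?_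
  have h0 : tι A Y i j n h' ≫ tproj A Y p q n h = 0 := by
    simp [tproj, show i ≠ p by lia]
  exact ConcreteCategory.congr_hom h0 x

theorem exact_whiskerLeft (M : ModuleCat.{u} S) [Projective M] {i j k : ℤ} (hi : i + 1 = j)
    (hj : j + 1 = k) (hY : IsZero (Y.homology j)) (u : (M ⊗ Y.X j : ModuleCat.{u} S))
    (hu : (M ◁ Y.d j k) u = 0) : ∃ v : (M ⊗ Y.X i : ModuleCat.{u} S), (M ◁ Y.d i j) v = u := by
  have := ModuleCat.projective_of_module_projective M
  have hex : Function.Exact (Y.d i j).hom (Y.d j k).hom := fun z =>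
    ⟨(exact_iff_homology Y i j k hi hj).1 hY z, by
      rintro ⟨w, rfl⟩
      exact ConcreteCategory.congr_hom (Y.d_comp_d i j k) w⟩
  exact (Module.Flat.lTensor_exact M hex u).1 hu

/-- If `A` is a complex of projective modules vanishing above degree `b` and the cohomology of `Y`
vanishes above degree `c`, then the cohomology of `A ⊗ Y` vanishes above degree `b + c`. -/
theorem isZero_homology_tens {b c n : ℤ} (hA : ∀ i, Projective (A.X i))
    (hb : ∀ i, b < i → IsZero (A.X i)) (hc : ∀ j, c < j → IsZero (Y.homology j)) (hn : b + c < n) :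
    IsZero ((tens A Y).homology n) := by
  rw [exact_iff_homology _ (n - 1) n (n + 1) (by lia) rfl]
  -- The filtration is zero from `b + 1` on and exhaustive, so induction on the number `k` of
  -- columns that a cocycle may occupy reaches every cocycle.
  suffices h : ∀ (k : ℕ) (z : (tens A Y).X n), z ∈ tensFil A Y (b + 1 - k) n →
      (tens A Y).d n (n + 1) z = 0 → ∃ w, (tens A Y).d (n - 1) n w = z by
    intro z hz
    obtain ⟨p, hp⟩ := exists_mem_tensFil z
    exact h (b + 1 - p).toNat z (tensFil_anti (by lia) hp) hz
  intro k
  induction k with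
  | zero =>
    intro z hz _
    rw [tensFil_eq_bot (fun i hi => hb i (by lia))] at hz
    exact ⟨0, by rw [map_zero, (Submodule.mem_bot S).1 hz]⟩
  | succ k ih =>
    intro z hz hdz
    obtain ⟨p, hp⟩ : ∃ p, p = b + 1 - ((k + 1 : ℕ) : ℤ) := ⟨_, rfl⟩
    rw [← hp] at hz
    obtain ⟨q, hq⟩ : ∃ q, p + q = n := ⟨n - p, by lia⟩
    obtain ⟨_, ⟨a, rfl⟩, z', hz', rfl⟩ := Submodule.mem_sup.1 (tensFil_le_sup hq hz)
    obtain ⟨ε, hε, y, hy⟩ := d_tι_apply p q n (q + 1) (n + 1) hq rfl rfl a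
    -- The leading component `a` of the cocycle is itself a vertical cocycle: all other terms of the
    -- differential lie in the next filtration step, which the projection onto column `p` kills.
    have hker : (A.X p ◁ Y.d q (q + 1)) a = 0 := by
      have h1 : tι A Y p (q + 1) (n + 1) (by lia) ((A.X p ◁ Y.d q (q + 1)) a) ∈
          tensFil A Y (p + 1) (n + 1) := by
        have h2 : ε • tι A Y p (q + 1) (n + 1) (by lia) ((A.X p ◁ Y.d q (q + 1)) a) =
            - y - (tens A Y).d n (n + 1) z' := by
          have h3 := (map_add ((tens A Y).d n (n + 1)).hom _ _).symm.trans hdz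
          have h4 := hy.2.symm.trans (eq_neg_of_add_eq_zero_left h3)
          rw [eq_sub_of_add_eq' h4]
          exact (neg_sub_left _ _).trans (by abel)
        have h5 := Submodule.smul_mem (tensFil A Y (p + 1) (n + 1)) ε
          (h2 ▸ Submodule.sub_mem _ (Submodule.neg_mem _ hy.1) (d_mem_tensFil rfl hz'))
        rwa [smul_smul, hε, one_smul] at h5
      exact (ConcreteCategory.congr_hom (tι_tproj p (q + 1) (n + 1) (by lia)) _).symm.trans
        (tproj_eq_zero _ h1)
    -- Since `p ≤ b`, the row index satisfies `q > c`, where `Y` is exact. Subtracting the boundary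
    -- of `± v` pushes the cocycle one step further into the filtration.
    obtain ⟨v, hv⟩ := exact_whiskerLeft (A.X p) (show (q - 1) + 1 = q by lia) rfl
      (hc q (by lia)) a hker
    obtain ⟨ε, hε, y, hy⟩ := d_tι_apply p (q - 1) (n - 1) q n (by lia) (by lia) (by lia) v
    rw [hv] at hy
    have h1 : tι A Y p q n hq a = (tens A Y).d (n - 1) n
        (ε • tι A Y p (q - 1) (n - 1) (by lia) v) - ε • y := by
      rw [map_smul, hy.2, smul_add, smul_smul, hε, one_smul]
      abel
    obtain ⟨w, hw⟩ := ih (z' - ε • y) (tensFil_anti (by lia) (Submodule.sub_mem _ hz'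
      (Submodule.smul_mem _ _ hy.1))) (by
        have h2 : (tens A Y).d n (n + 1) ((tι A Y p q n hq) a + z' -
            (tens A Y).d (n - 1) n (ε • tι A Y p (q - 1) (n - 1) (by lia) v)) = 0 := by
          rw [map_sub]
          refine (congrArg₂ (· - ·) hdz
            (ConcreteCategory.congr_hom ((tens A Y).d_comp_d (n - 1) n (n + 1)) _)).trans ?_
          exact sub_self 0
        rw [h1] at h2
        rw [← h2]
        congr 1
        abel)
    refine ⟨ε • tι A Y p (q - 1) (n - 1) (by lia) v + w, ?_⟩
    rw [map_add, hw]
    refine Eq.trans ?_ (congrArg (· + z') h1).symm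
    abel

end Flat

/-! ### Bounded complexes of projectives: replacement, lifting and finiteness -/

section ProjectiveComplexes

variable {R S : Type u} [CommRing R] [CommRing S] (φ : R →+* S)

/-- A complex of projective modules vanishing in high cohomological degrees. -/
structure ProjBdd (X : Cpx R) : Prop where
  projective : ∀ i, Projective (X.X i)
  bounded : ∃ b : ℤ, ∀ i, b < i → IsZero (X.X i)

theorem IsProjRes.projBdd {P L : Cpx R} {π : P ⟶ L} (h : IsProjRes π) : ProjBdd P where
  projective := h.projective
  bounded := by
    obtain ⟨b, hb⟩ := h.bounded
    exact ⟨b, fun i hi => P.isZero_of_isStrictlyLE b i hi⟩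

theorem ProjBdd.isKProjective {X : Cpx R} (h : ProjBdd X) : X.IsKProjective := by
  obtain ⟨b, hb⟩ := h.bounded
  have : X.IsStrictlyLE b := (CochainComplex.isStrictlyLE_iff _ _).2 hb
  have := h.projective
  exact CochainComplex.isKProjective_of_projective X b

theorem ProjBdd.extC {X : Cpx R} (h : ProjBdd X) : ProjBdd ((extC φ).obj X) where
  projective i := (ModuleCat.extendRestrictScalarsAdj φ).map_projective _ (h.projective i)
  bounded := by
    obtain ⟨b, hb⟩ := h.bounded
    exact ⟨b, fun i hi => (ModuleCat.extendScalars φ).map_isZero (hb i hi)⟩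

theorem isZero_tensor_left {M N : ModuleCat.{u} R} (h : IsZero M) :
    IsZero (M ⊗ N : ModuleCat.{u} R) := by
  rw [IsZero.iff_id_eq_zero, ← MonoidalCategory.id_whiskerRight,
    (IsZero.iff_id_eq_zero _).1 h, MonoidalPreadditive.zero_whiskerRight]

theorem isZero_tensor_right {M N : ModuleCat.{u} R} (h : IsZero N) :
    IsZero (M ⊗ N : ModuleCat.{u} R) := by
  rw [IsZero.iff_id_eq_zero, ← MonoidalCategory.whiskerLeft_id,
    (IsZero.iff_id_eq_zero _).1 h, MonoidalPreadditive.whiskerLeft_zero]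

theorem projective_tensor (M N : ModuleCat.{u} R) [Projective M] [Projective N] :
    Projective (M ⊗ N : ModuleCat.{u} R) := by
  have := ModuleCat.projective_of_module_projective M
  have := ModuleCat.projective_of_module_projective N
  exact (IsProjective.iff_projective (R := R) (TensorProduct R M N)).1 inferInstance

theorem ProjBdd.tens {X Y : Cpx R} (hX : ProjBdd X) (hY : ProjBdd Y) : ProjBdd (tens X Y) where
  projective n :=
    { factors := fun f e _ => by
        have (i j : ℤ) : Projective (X.X i ⊗ Y.X j) := by
          have := hX.projective i
          have := hY.projective j
          exact projective_tensor _ _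
        exact ⟨tdesc fun i j h => Projective.factorThru (tι X Y i j n h ≫ f) e,
          tens_hom_ext fun i j h => by simp⟩ }
  bounded := by
    obtain ⟨b, hb⟩ := hX.bounded
    obtain ⟨c, hc⟩ := hY.bounded
    refine ⟨b + c, fun n hn => ?_⟩
    rw [IsZero.iff_id_eq_zero]
    refine tens_hom_ext fun i j h => IsZero.eq_of_src ?_ _ _
    by_cases hi : b < i
    · exact isZero_tensor_left (hb i hi)
    · exact isZero_tensor_right (hc j (by lia))

theorem ProjBdd.of_split {T : ShortComplex (Cpx R)} (σ : DegSplit T) (h1 : ProjBdd T.X₁)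
    (h3 : ProjBdd T.X₃) : ProjBdd T.X₂ where
  projective n :=
    { factors := fun f e _ => by
        have := h1.projective n
        have := h3.projective n
        refine ⟨σ.r n ≫ Projective.factorThru (T.f.f n ≫ f) e +
          T.g.f n ≫ Projective.factorThru (σ.s n ≫ f) e, ?_⟩
        rw [Preadditive.add_comp, Category.assoc, Category.assoc, Projective.factorThru_comp,
          Projective.factorThru_comp, ← Category.assoc, ← Category.assoc, ← Preadditive.add_comp,
          σ.id, Category.id_comp] }
  bounded := by
    obtain ⟨b, hb⟩ := h1.bounded
    obtain ⟨c, hc⟩ := h3.bounded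
    refine ⟨max b c, fun n hn => ?_⟩
    rw [IsZero.iff_id_eq_zero, ← σ.id n,
      (hb n (lt_of_le_of_lt (le_max_left _ _) hn)).eq_of_tgt (σ.r n) 0,
      (hc n (lt_of_le_of_lt (le_max_right _ _) hn)).eq_of_tgt (T.g.f n) 0, zero_comp, zero_comp,
      add_zero]

theorem ProjBdd.shift {X : Cpx R} (h : ProjBdd X) (n : ℤ) : ProjBdd (X⟦n⟧) where
  projective i := h.projective (i + n)
  bounded := by
    obtain ⟨b, hb⟩ := h.bounded
    exact ⟨b - n, fun i hi => hb (i + n) (by lia)⟩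

theorem ProjBdd.cone {X Z : Cpx R} (f : X ⟶ Z) (hX : ProjBdd X) (hZ : ProjBdd Z) :
    ProjBdd (CochainComplex.mappingCone f) :=
  ProjBdd.of_split (coneSeqSplit f) hZ (hX.shift 1)

theorem ProjBdd.single (M : ModuleCat.{u} R) [Projective M] (e : ℤ) :
    ProjBdd ((HomologicalComplex.single (ModuleCat.{u} R) (ComplexShape.up ℤ) e).obj M) where
  projective i := by
    by_cases h : i = e
    · exact Projective.of_iso (HomologicalComplex.singleObjXIsoOfEq _ e M i h).symm inferInstance
    · exact (HomologicalComplex.isZero_single_obj_X _ e M i h).projective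
  bounded := ⟨e, fun i hi => HomologicalComplex.isZero_single_obj_X _ e M i (by lia)⟩

/-- The resolution is the opposite of an injective resolution of the truncated complex in the
opposite category. The top degree is controlled here because the dévissage arguments work at the top
of the complex. -/
theorem exists_projRes_le (L : Cpx R) (b : ℤ) (hb : ∀ i, b < i → IsZero (L.homology i)) :
    ∃ (P : Cpx R) (π : P ⟶ L), IsProjRes π ∧ ∀ i, b < i → IsZero (P.X i) := by
  have hb : L.IsLE b := (CochainComplex.isLE_iff _ _).2 fun i hi =>
    (HomologicalComplex.exactAt_iff_isZero_homology _ _).2 (hb i hi)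
  let K := L.truncLE b
  let e := CochainComplex.opEquivalence (ModuleCat.{u} R)
  let K' := e.functor.obj (Opposite.op K)
  have hK' : K'.IsStrictlyGE (-b) := by
    rw [CochainComplex.isStrictlyGE_iff]
    intro i hi
    exact (K.isZero_of_isStrictlyLE b (-i) (by lia)).op
  obtain ⟨J, i, hi, hJ, hJb⟩ :=
    CochainComplex.Plus.modelCategoryQuillen.exists_quasiIso_injective K' (-b)
  let P : Cpx R := (e.inverse.obj J).unop
  let g : P ⟶ K := (e.unitIso.hom.app (Opposite.op K) ≫ e.inverse.map i).unop
  have hg : QuasiIso g := by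
    have h1 : g = (e.inverse.map i).unop ≫ (e.unitIso.hom.app (Opposite.op K)).unop := rfl
    have h2 : QuasiIso (e.inverse.map i).unop := by
      rw [quasiIso_iff]
      intro n
      rw [quasiIsoAt_iff' _ (n - 1) n (n + 1) (by simp) (by simp),
        ← ShortComplex.quasiIso_opMap_iff]
      have h3 := (quasiIsoAt_iff' i (-(n + 1)) (-n) (-(n - 1))
        (by simp; ring) (by simp; ring)).1
        inferInstance
      exact h3
    rw [h1]
    infer_instance
  have hz : ∀ n, b < n → IsZero (P.X n) := fun n hn =>
    (J.isZero_of_isStrictlyGE (-b) (-n) (by lia)).unop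
  refine ⟨P, g ≫ L.ιTruncLE b, ⟨fun n => ?_, ⟨b, (CochainComplex.isStrictlyLE_iff _ _).2 hz⟩,
    inferInstance⟩, hz⟩
  have := hJ (-n)
  exact inferInstanceAs (Projective (Opposite.unop (J.X (-n))))

theorem projRes_spec (L : Cpx R) (hL : HomologyBoundedBelow L) :
    ∃ π : projRes L hL ⟶ L, IsProjRes π :=
  (exists_isProjRes hL).choose_spec

/-- Replacing a complex of projectives by one vanishing above its top cohomological degree. -/
theorem ProjBdd.exists_replacement {X : Cpx R} (hX : ProjBdd X) (e : ℤ)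
    (he : ∀ i, e < i → IsZero (X.homology i)) :
    ∃ X' : Cpx R, ProjBdd X' ∧ (∀ i, e < i → IsZero (X'.X i)) ∧
      (∀ i, Nonempty (X'.homology i ≅ X.homology i)) ∧
      ∀ (V : Cpx S) i, Nonempty ((tensor φ X' V).homology i ≅ (tensor φ X V).homology i) := by
  obtain ⟨P, π, hπ, hP⟩ := exists_projRes_le X e he
  have hq := hπ.quasiIso
  have := hπ.projBdd.isKProjective
  have := hX.isKProjective
  refine ⟨P, hπ.projBdd, hP, fun i => ⟨asIso (HomologicalComplex.homologyMap π i)⟩, fun V i => ?_⟩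
  -- A quasi-isomorphism of K-projective complexes is a homotopy equivalence, and those are
  -- preserved by tensoring with any `V`.
  obtain ⟨E, rfl⟩ := (CochainComplex.IsKProjective.quasiIso_iff π).1 hq
  let E' : HomotopyEquiv ((tfun φ V).obj P) ((tfun φ V).obj X) :=
    { hom := (tfun φ V).map E.hom
      inv := (tfun φ V).map E.inv
      homotopyHomInvId := (Homotopy.ofEq ((tfun φ V).map_comp _ _).symm).trans
        ((tfunHomotopy φ E.homotopyHomInvId V).trans (Homotopy.ofEq ((tfun φ V).map_id _)))
      homotopyInvHomId := (Homotopy.ofEq ((tfun φ V).map_comp _ _).symm).trans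
        ((tfunHomotopy φ E.homotopyInvHomId V).trans (Homotopy.ofEq ((tfun φ V).map_id _))) }
  exact ⟨E'.toHomologyIso i⟩

/-- Vanishing of the cohomology of `(S ⊗_R X) ⊗_S V` in high degrees. -/
theorem ProjBdd.isZero_homology_tensor {X : Cpx R} (hX : ProjBdd X) {V : Cpx S} {e c m : ℤ}
    (he : ∀ i, e < i → IsZero (X.homology i)) (hc : ∀ j, c < j → IsZero (V.homology j))
    (hm : e + c < m) : IsZero ((tensor φ X V).homology m) := by
  obtain ⟨X', hX', hz, -, hi⟩ := hX.exists_replacement φ e he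
  obtain ⟨i⟩ := hi V m
  refine IsZero.of_iso ?_ i.symm
  exact isZero_homology_tens (hX'.extC φ).projective
    (fun i hi => (ModuleCat.extendScalars φ).map_isZero (hz i hi)) hc hm

/-- Out of a K-projective complex, morphisms in the derived category are homotopy classes of chain
maps, and `π` is invertible there. -/
theorem exists_lift {X P Y : Cpx R} (hX : ProjBdd X) (π : P ⟶ Y) [QuasiIso π] (g : X ⟶ Y) :
    ∃ f : X ⟶ P, Nonempty (Homotopy (f ≫ π) g) := by
  have := hX.isKProjective
  let := HasDerivedCategory.standard (ModuleCat.{u} R)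
  have hq : IsIso (DerivedCategory.Q.map π) := inferInstance
  have hq : IsIso (DerivedCategory.Qh.map ((HomotopyCategory.quotient _ _).map π)) := hq
  obtain ⟨f', hf'⟩ := (CochainComplex.IsKProjective.Qh_map_bijective X
    ((HomotopyCategory.quotient _ _).obj P)).surjective
      (DerivedCategory.Qh.map ((HomotopyCategory.quotient _ _).map g) ≫
        inv (DerivedCategory.Qh.map ((HomotopyCategory.quotient _ _).map π)))
  obtain ⟨f, rfl⟩ := (HomotopyCategory.quotient _ _).map_surjective f'
  refine ⟨f, ⟨HomotopyCategory.homotopyOfEq _ _ ?_⟩⟩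
  refine (CochainComplex.IsKProjective.Qh_map_bijective X _).injective ?_
  rw [Functor.map_comp, Functor.map_comp, hf', Category.assoc, IsIso.inv_hom_id, Category.comp_id]

theorem isZero_homology_cone {X Z : Cpx R} (f : X ⟶ Z) [hf : QuasiIso f] (i : ℤ) :
    IsZero ((CochainComplex.mappingCone f).homology i) := by
  have h1 : HomotopyCategory.quasiIso _ _ ((HomotopyCategory.quotient _ _).map f) :=
    (HomotopyCategory.quotient_map_mem_quasiIso_iff f).2 hf
  rw [HomotopyCategory.quasiIso_eq_trW_subcategoryAcyclic] at h1
  have h2 := (ObjectProperty.trW_iff_of_distinguished _ _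
    (HomotopyCategory.mappingCone_triangleh_distinguished f)).1 h1
  exact (HomologicalComplex.exactAt_iff_isZero_homology _ _).1
    ((HomotopyCategory.quotient_obj_mem_subcategoryAcyclic_iff_acyclic _).1 h2 i)

/-- The cone of `f` is acyclic and remains so after tensoring with `A`. This later allows a
resolution of `L` to be exchanged for `L` in its Betti numbers. -/
theorem length_homology_tens_of_quasiIso {X Z : Cpx R} (f : X ⟶ Z) [QuasiIso f] {A : Cpx R}
    (hA : ProjBdd A) (i : ℤ) : Module.length R ((tens A X).homology i) =
      Module.length R ((tens A Z).homology i) := by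
  let e (W : Cpx R) (j : ℤ) :
      (tensor (RingHom.id R) W A).homology j ≅ (tens A W).homology j :=
    (HomologicalComplex.homologyFunctor _ _ j).mapIso (tensorId W A ≪≫ tensComm W A)
  obtain ⟨b, hb⟩ := hA.bounded
  have hz (j : ℤ) :
      IsZero ((tensor (RingHom.id R) (CochainComplex.mappingCone f) A).homology j) :=
    -- The cone has no cohomology at all, so the threshold `c` can be chosen to suit the degree `j`.
    IsZero.of_iso (isZero_homology_tens (b := b) (c := j - 1 - b) hA.projective hb
      (fun j _ => isZero_homology_cone f j) (by lia)) (e _ j)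
  exact length_eq_of_ex ((cone_tensor_ex₃ (RingHom.id R) A f (i - 1) i (by lia)).congr (Iso.refl _)
    (e X i) (e Z i)) ((cone_tensor_ex₁ (RingHom.id R) A f i).congr (e X i) (e Z i) (Iso.refl _))
    (hz _) (hz _)

/-- The shift of a complex concentrated in degree `0`. -/
def singleShift (M : ModuleCat.{u} R) (e : ℤ) :
    ((HomologicalComplex.single (ModuleCat.{u} R) (ComplexShape.up ℤ) 0).obj M)⟦-e⟧ ≅
      (HomologicalComplex.single (ModuleCat.{u} R) (ComplexShape.up ℤ) e).obj M :=
  ((CochainComplex.singleFunctors (ModuleCat.{u} R)).shiftIso (-e) e 0 (by lia)).app M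

/-- The cohomology of a shifted derived tensor product. -/
def homologyTensorShift (X : Cpx R) (V : Cpx S) (n i j : ℤ) (h : n + i = j) :
    (tensor φ (X⟦n⟧) V).homology i ≅ (tensor φ X V).homology j :=
  (HomologicalComplex.homologyFunctor _ _ i).mapIso (tfunShift φ X V n) ≪≫
    homologyShift (tensor φ X V) n i j h

/-- Extension of scalars of the ring itself. -/
def extCUnit : (extC φ).obj ((HomologicalComplex.single (ModuleCat.{u} R) (ComplexShape.up ℤ) 0).obj
      (ModuleCat.of R R)) ≅
    (HomologicalComplex.single (ModuleCat.{u} S) (ComplexShape.up ℤ) 0).obj (ModuleCat.of S S) :=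
  (HomologicalComplex.singleMapHomologicalComplex (ModuleCat.extendScalars.{u, u, u} φ)
    (ComplexShape.up ℤ) 0).app (ModuleCat.of R R) ≪≫
    (HomologicalComplex.single (ModuleCat.{u} S) (ComplexShape.up ℤ) 0).mapIso
      (Functor.Monoidal.εIso (ModuleCat.extendScalars.{u, u, u} φ)).symm

theorem finite_biproduct {r : ℕ} (M : Fin r → ModuleCat.{u} S) (h : ∀ i, Module.Finite S (M i)) :
    Module.Finite S (⨁ M : ModuleCat.{u} S) :=
  Module.Finite.equiv (ModuleCat.biproductIsoPi M).toLinearEquiv.symm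

/-- The functor is additive, which reduces to rank one, where the tensor product is a shift of `V`.
-/
theorem finite_homology_tensor_single (r : ℕ) (e m : ℤ) (V : Cpx S)
    (hV : ∀ j, Module.Finite S (V.homology j)) :
    Module.Finite S ((tensor φ ((HomologicalComplex.single (ModuleCat.{u} R)
      (ComplexShape.up ℤ) e).obj (⨁ fun _ : Fin r => ModuleCat.of R R)) V).homology m) := by
  let Φ : ModuleCat.{u} R ⥤ ModuleCat.{u} S :=
    HomologicalComplex.single (ModuleCat.{u} R) (ComplexShape.up ℤ) e ⋙ tfun φ V ⋙
      HomologicalComplex.homologyFunctor _ _ m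
  have : Φ.Additive := inferInstance
  refine finite_of_iso (Φ.mapBiproduct fun _ : Fin r => ModuleCat.of R R).symm
    (finite_biproduct _ fun _ => ?_)
  refine finite_of_iso ?_ (hV (m - e))
  exact ((HomologicalComplex.homologyFunctor _ _ _).mapIso
    ((unitTens V).symm ≪≫ tensCongr (extCUnit φ).symm (Iso.refl V))) ≪≫
    (homologyTensorShift φ _ V (-e) m (m - e) (by lia)).symm ≪≫
    (tfun φ V ⋙ HomologicalComplex.homologyFunctor _ _ m).mapIso (singleShift (ModuleCat.of R R) e)

theorem projective_biproduct_self (r : ℕ) :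
    Projective (⨁ fun _ : Fin r => ModuleCat.of R R : ModuleCat.{u} R) where
  factors f e _ := by
    have : Projective (ModuleCat.of R R) :=
      (IsProjective.iff_projective (R := R) R).1 inferInstance
    refine ⟨biproduct.desc fun b =>
      Projective.factorThru (biproduct.ι (fun _ : Fin r => ModuleCat.of R R) b ≫ f) e, ?_⟩
    refine biproduct.hom_ext' _ _ fun b => ?_
    rw [biproduct.ι_desc_assoc, Projective.factorThru_comp]

theorem exists_epi_of_finite (M : ModuleCat.{u} R) (h : Module.Finite R M) :
    ∃ (r : ℕ) (f : (⨁ fun _ : Fin r => ModuleCat.of R R) ⟶ M), Epi f := by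
  obtain ⟨r, g, hg⟩ := Module.Finite.exists_fin (R := R) (M := M)
  let f : (⨁ fun _ : Fin r => ModuleCat.of R R) ⟶ M :=
    biproduct.desc fun i => ModuleCat.ofHom (LinearMap.toSpanSingleton R M (g i))
  refine ⟨r, f, ?_⟩
  rw [ModuleCat.epi_iff_range_eq_top, ← top_le_iff, ← hg, Submodule.span_le]
  rintro _ ⟨i, rfl⟩
  refine ⟨biproduct.ι (fun _ : Fin r => ModuleCat.of R R) i (1 : R), ?_⟩
  have := ConcreteCategory.congr_hom (biproduct.ι_desc
    (fun i : Fin r => ModuleCat.ofHom (LinearMap.toSpanSingleton R M (g i))) i) (1 : R)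
  exact this.trans (one_smul R (g i))

/-- A map onto the top cohomology module lifts to a map from a complex concentrated in one degree. -/
theorem exists_single_hom (X : Cpx R) (e : ℤ) (P : ModuleCat.{u} R) [Projective P]
    (f : P ⟶ X.homology e) [Epi f] :
    ∃ g : (HomologicalComplex.single (ModuleCat.{u} R) (ComplexShape.up ℤ) e).obj P ⟶ X,
      Epi (HomologicalComplex.homologyMap g e) := by
  let f' : P ⟶ X.cycles e := Projective.factorThru f (X.homologyπ e)
  let g : (HomologicalComplex.single (ModuleCat.{u} R) (ComplexShape.up ℤ) e).obj P ⟶ X :=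
    HomologicalComplex.mkHomFromSingle (f' ≫ X.iCycles e) (fun k _ => by simp)
  refine ⟨g, ?_⟩
  have h1 : (HomologicalComplex.singleObjHomologySelfIso _ e P).inv ≫
      HomologicalComplex.homologyMap g e = f := by
    rw [← HomologicalComplex.singleObjCyclesSelfIso_inv_homologyπ, Category.assoc,
      HomologicalComplex.homologyπ_naturality, ← Projective.factorThru_comp f (X.homologyπ e)]
    have h2 : (HomologicalComplex.singleObjCyclesSelfIso _ e P).inv ≫
        HomologicalComplex.cyclesMap g e = f' := by
      rw [← cancel_mono (X.iCycles e), Category.assoc, HomologicalComplex.cyclesMap_i,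
        HomologicalComplex.singleObjCyclesSelfIso_inv_iCycles_assoc,
        HomologicalComplex.mkHomFromSingle_f, Iso.inv_hom_id_assoc]
    rw [reassoc_of% h2]
  have : Epi ((HomologicalComplex.singleObjHomologySelfIso (ComplexShape.up ℤ) e P).inv ≫
      HomologicalComplex.homologyMap g e) := by rw [h1]; infer_instance
  exact epi_of_epi (HomologicalComplex.singleObjHomologySelfIso _ e P).inv _

/-- As `X` vanishes above `e`, its top cohomology is a quotient of `X^e`; maps out of it are
therefore chain maps out of `X`. -/
theorem exists_hom_single (X : Cpx R) (e : ℤ) (hX : ∀ i, e < i → IsZero (X.X i))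
    (K : ModuleCat.{u} R) (h : X.homology e ⟶ K) [Epi h] :
    ∃ g : X ⟶ (HomologicalComplex.single (ModuleCat.{u} R) (ComplexShape.up ℤ) e).obj K,
      Epi (HomologicalComplex.homologyMap g e) := by
  let ι := X.isoHomologyι e (e + 1) (by simp) ((hX (e + 1) (by lia)).eq_of_tgt _ _)
  let g : X ⟶ (HomologicalComplex.single (ModuleCat.{u} R) (ComplexShape.up ℤ) e).obj K :=
    HomologicalComplex.mkHomToSingle (X.pOpcycles e ≫ ι.inv ≫ h) (fun i _ => by simp)
  refine ⟨g, ?_⟩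
  have h1 : HomologicalComplex.homologyMap g e ≫
      (HomologicalComplex.singleObjHomologySelfIso _ e K).hom = h := by
    rw [← HomologicalComplex.homologyι_singleObjOpcyclesSelfIso_inv,
      HomologicalComplex.homologyι_naturality_assoc]
    have h2 : HomologicalComplex.opcyclesMap g e ≫
        (HomologicalComplex.singleObjOpcyclesSelfIso _ e K).inv = ι.inv ≫ h := by
      rw [← cancel_epi (X.pOpcycles e), HomologicalComplex.p_opcyclesMap_assoc,
        HomologicalComplex.pOpcycles_singleObjOpcyclesSelfIso_inv,
        HomologicalComplex.mkHomToSingle_f, Category.assoc, Iso.inv_hom_id, Category.comp_id]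
    rw [h2]
    exact ι.hom_inv_id_assoc h
  have : HomologicalComplex.homologyMap g e =
      h ≫ (HomologicalComplex.singleObjHomologySelfIso _ e K).inv := by
    rw [← h1, Category.assoc, Iso.hom_inv_id, Category.comp_id]
  rw [this]
  exact epi_comp _ _

/-- Finiteness of the cohomology of `(S ⊗_R X) ⊗_S V`. -/
theorem ProjBdd.finite_homology_tensor [IsNoetherianRing R] [IsNoetherianRing S] {V : Cpx S} {c : ℤ}
    (hc : ∀ j, c < j → IsZero (V.homology j)) (hV : ∀ j, Module.Finite S (V.homology j))
    {X : Cpx R} (hX : ProjBdd X) (hXf : ∀ i, Module.Finite R (X.homology i)) (m : ℤ) :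
    Module.Finite S ((tensor φ X V).homology m) := by
  obtain ⟨e, he⟩ := hX.bounded
  replace he : ∀ i, e < i → IsZero (X.homology i) := fun i hi =>
    (HomologicalComplex.exactAt_iff_isZero_homology _ _).1
      (ShortComplex.exact_of_isZero_X₂ _ (he i hi))
  -- For `k = 0` the degree `m` lies in the vanishing range. Each step covers the top cohomology by
  -- a finite free module and passes to the cone, whose top degree is at most `e - 1`.
  obtain ⟨k, hk⟩ : ∃ k : ℕ, e + c - k < m := ⟨(e + c - m + 1).toNat, by lia⟩
  induction k generalizing X e with
  | zero =>
    have := ModuleCat.subsingleton_of_isZero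
      (hX.isZero_homology_tensor φ he hc (show e + c < m by simpa using hk))
    infer_instance
  | succ k ih =>
    obtain ⟨X', hX', hz, hi, hi'⟩ := hX.exists_replacement φ e he
    obtain ⟨i'⟩ := hi' V m
    refine finite_of_iso i' ?_
    have hf (i : ℤ) : Module.Finite R (X'.homology i) :=
      (hi i).elim fun a => finite_of_iso a.symm (hXf i)
    have := projective_biproduct_self (R := R)
    obtain ⟨r, f, _⟩ := exists_epi_of_finite _ (hf e)
    obtain ⟨g, hg⟩ := exists_single_hom X' e _ f
    have hs (i : ℤ) (h : i ≠ e) : IsZero (((HomologicalComplex.single (ModuleCat.{u} R)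
        (ComplexShape.up ℤ) e).obj (⨁ fun _ : Fin r => ModuleCat.of R R)).homology i) :=
      HomologicalComplex.isZero_single_obj_homology _ _ _ _ h
    have hsf (i : ℤ) : Module.Finite R (((HomologicalComplex.single (ModuleCat.{u} R)
        (ComplexShape.up ℤ) e).obj (⨁ fun _ : Fin r => ModuleCat.of R R)).homology i) := by
      by_cases h : i = e
      · subst h
        exact finite_of_iso (HomologicalComplex.singleObjHomologySelfIso _ _ _).symm
          (finite_biproduct _ fun _ => inferInstanceAs (Module.Finite R R))
      · have := ModuleCat.subsingleton_of_isZero (hs i h)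
        infer_instance
    have hX'0 (i : ℤ) (h : e < i) : IsZero (X'.homology i) :=
      (hi i).elim fun a => IsZero.of_iso (he i h) a
    refine (cone_tensor_ex₁ φ V g m).finite (finite_homology_tensor_single φ r e m V hV) ?_
    refine ih (ProjBdd.cone g (ProjBdd.single _ e) hX') (fun i => ?_) (e - 1) (fun i h => ?_)
      (by push_cast at hk; lia)
    · exact (cone_ex₂ g i (i + 1) rfl).finite (hf i) (hsf _)
    · by_cases h' : i = e
      · subst h'
        exact cone_isZero_of_epi g i (i + 1) rfl hg (hs _ (by lia))
      · exact (cone_ex₂ g i (i + 1) rfl).isZero (hX'0 i (by lia)) (hs _ (by lia))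

end ProjectiveComplexes

/-! ### Dévissage: bounding lengths by a convolution -/

section LengthBound

open IsLocalRing

variable {R S : Type u} [CommRing R] [CommRing S] (φ : R →+* S)

/-- A nonzero module of finite length has a maximal proper submodule, and the simple quotient over a
local ring is the residue field. -/
theorem exists_epi_residueField [IsLocalRing R] (M : ModuleCat.{u} R)
    (h0 : Module.length R M ≠ 0) (h : Module.length R M ≠ ⊤) :
    ∃ f : M ⟶ ModuleCat.of R (ResidueField R), Epi f := by
  have h1 := Module.length_ne_top_iff.1 h
  have := (isFiniteLength_iff_isNoetherian_isArtinian.1 h1).1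
  have : Nontrivial M := not_subsingleton_iff_nontrivial.1 fun _ => h0 Module.length_eq_zero
  obtain ⟨N, hN⟩ := IsCoatomic.exists_coatom (Submodule R M)
  have := isSimpleModule_iff_isCoatom.2 hN
  obtain ⟨I, hI, ⟨E⟩⟩ := (isSimpleModule_iff_quot_maximal (R := R) (M := M ⧸ N)).1 this
  obtain rfl := eq_maximalIdeal hI
  exact ⟨ModuleCat.ofHom (E.toLinearMap ∘ₗ N.mkQ), (ModuleCat.epi_iff_surjective _).2
    (E.surjective.comp N.mkQ_surjective)⟩

theorem length_residueField [IsLocalRing R] : Module.length R (ResidueField R) = 1 :=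
  Module.length_eq_one_iff.2 (isSimpleModule_iff_quot_maximal.2
    ⟨maximalIdeal R, inferInstance, ⟨LinearEquiv.refl _ _⟩⟩)

variable (R) in
/-- A projective resolution of the residue field. -/
abbrev resField [IsLocalRing R] : Cpx R := projRes (residueCpx R) (residueCpx_bounded R)

theorem length_homology_resField [IsLocalRing R] (e i : ℤ) :
    Module.length R (((resField R)⟦-e⟧).homology i) = if i = e then 1 else 0 := by
  obtain ⟨π, hπ⟩ := projRes_spec (residueCpx R) (residueCpx_bounded R)
  have := hπ.quasiIso
  rw [length_eq_of_iso (homologyShift _ (-e) i (i - e) (by lia)),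
    length_eq_of_iso (asIso (HomologicalComplex.homologyMap π (i - e)))]
  split_ifs with h
  · subst h
    rw [sub_self]
    exact (length_eq_of_iso (HomologicalComplex.singleObjHomologySelfIso _ _ _)).trans
      length_residueField
  · have : Subsingleton ((residueCpx R).homology (i - e)) :=
      ModuleCat.subsingleton_of_isZero (HomologicalComplex.isZero_single_obj_homology
      (ComplexShape.up ℤ) 0 (ModuleCat.of R (ResidueField R)) (i - e) (by lia))
    exact Module.length_eq_zero

/-- Splitting off a copy of the residue field from the top cohomology of a complex. -/
theorem ProjBdd.exists_reduction [IsLocalRing R] {X : Cpx R} (hX : ProjBdd X) (e : ℤ)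
    (he : ∀ i, e < i → IsZero (X.homology i)) (h0 : Module.length R (X.homology e) ≠ 0)
    (h : Module.length R (X.homology e) ≠ ⊤) :
    ∃ C : Cpx R, ProjBdd C ∧ (∀ i, Module.length R (X.homology i) =
        Module.length R (C.homology i) + if i = e then 1 else 0) ∧
      ∀ (V : Cpx S) m, Module.length S ((tensor φ X V).homology m) ≤
        Module.length S ((tensor φ C V).homology m) +
          Module.length S ((tensor φ (resField R) V).homology (m - e)) := by
  obtain ⟨X', hX', hz, hi, ht⟩ := hX.exists_replacement φ e he
  have hl (i) : Module.length R (X'.homology i) = Module.length R (X.homology i) :=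
    (hi i).elim length_eq_of_iso
  have he' (i) (h : e < i) : IsZero (X'.homology i) := (hi i).elim fun a => IsZero.of_iso (he i h) a
  obtain ⟨p, _⟩ := exists_epi_residueField (X'.homology e) (by rwa [hl]) (by rwa [hl])
  obtain ⟨g, hg⟩ := exists_hom_single X' e hz _ p
  obtain ⟨π, hπ⟩ := projRes_spec (residueCpx R) (residueCpx_bounded R)
  have := hπ.quasiIso
  let σ : (residueCpx R)⟦-e⟧ ≅ (HomologicalComplex.single (ModuleCat.{u} R)
      (ComplexShape.up ℤ) e).obj (ModuleCat.of R (ResidueField R)) := singleShift _ e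
  let π' : (resField R)⟦-e⟧ ⟶ (HomologicalComplex.single (ModuleCat.{u} R)
      (ComplexShape.up ℤ) e).obj (ModuleCat.of R (ResidueField R)) :=
    π⟦-e⟧' ≫ σ.hom
  have : QuasiIso (π⟦-e⟧') := inferInstance
  have : QuasiIso π' := quasiIso_comp _ _
  -- The map to `k[-e]` is lifted to its projective resolution, so that the cone is again a bounded
  -- complex of projectives and the induction can continue.
  obtain ⟨f, ⟨hf⟩⟩ := exists_lift hX' π' g
  have hfe : Epi (HomologicalComplex.homologyMap f e) := by
    have h1 := hf.homologyMap_eq e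
    rw [HomologicalComplex.homologyMap_comp] at h1
    rw [← Category.comp_id (HomologicalComplex.homologyMap f e),
      ← IsIso.hom_inv_id (HomologicalComplex.homologyMap π' e), ← Category.assoc, h1]
    exact epi_comp _ _
  have hQ (i : ℤ) (h : i ≠ e) : IsZero (((resField R)⟦-e⟧).homology i) := by
    have := length_homology_resField (R := R) e i
    rw [if_neg h, Module.length_eq_zero_iff] at this
    exact ModuleCat.isZero_of_subsingleton _
  have hQP : ProjBdd ((resField R)⟦-e⟧) := hπ.projBdd.shift _
  -- The witness is the homotopy fibre of `f`: as `f` is onto in degree `e`, its cohomology differs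
  -- from that of `X` only by one copy of `k` there.
  refine ⟨(CochainComplex.mappingCone f)⟦(-1 : ℤ)⟧, (hX'.cone f hQP).shift _, fun i => ?_,
    fun V m => ?_⟩
  · rw [length_eq_of_iso (homologyShift (CochainComplex.mappingCone f) (-1) i (i - 1) (by lia)),
      ← hl]
    rcases lt_trichotomy i e with h | rfl | h
    · rw [if_neg h.ne, add_zero]
      exact (length_eq_of_ex (cone_ex₂ f (i - 1) i (by lia)) (cone_ex₃ f (i - 1) i (by lia))
        (hQ _ (by lia)) (hQ _ (by lia))).symm
    · rw [if_pos rfl, cone_length_of_epi f (i - 1) i (by lia) hfe (hQ _ (by lia)),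
        length_homology_resField, if_pos rfl]
    · have h1 : IsZero ((CochainComplex.mappingCone f).homology (i - 1)) := by
        by_cases h' : i - 1 = e
        · subst h'
          exact cone_isZero_of_epi f (i - 1) i (by lia) hfe (he' _ h)
        · exact (cone_ex₂ f (i - 1) i (by lia)).isZero (hQ _ h') (he' _ h)
      have := ModuleCat.subsingleton_of_isZero h1
      have := ModuleCat.subsingleton_of_isZero (he' _ h)
      rw [if_neg h.ne', Module.length_eq_zero, Module.length_eq_zero, add_zero]
  · obtain ⟨i'⟩ := ht V m
    rw [← length_eq_of_iso i', length_eq_of_iso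
      (homologyTensorShift φ (CochainComplex.mappingCone f) V (-1) m (m - 1) (by lia)),
      ← length_eq_of_iso (homologyTensorShift φ (resField R) V (-e) m (m - e) (by lia))]
    exact (cone_tensor_ex₃ φ V f (m - 1) m (by lia)).length_le

/-- The length of `H(X ⊗ V)` is bounded by a convolution of the lengths of `H(X)` and
`H(k ⊗ V)`. -/
theorem ProjBdd.length_homology_tensor_le [IsLocalRing R] {V : Cpx S} {a c m : ℤ}
    (hc : ∀ j, c < j → IsZero (V.homology j)) {X : Cpx R} (hX : ProjBdd X)
    (ha : ∀ i, a < i → IsZero (X.homology i))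
    (hX' : ∀ i, Module.length R (X.homology i) ≠ ⊤) :
    Module.length S ((tensor φ X V).homology m) ≤ ∑ i ∈ Finset.Icc (m - c) a,
      Module.length R (X.homology i) *
        Module.length S ((tensor φ (resField R) V).homology (m - i)) := by
  -- The induction is on the total length of the cohomology of `X` in degrees `m - c` to `a`. Once
  -- it is zero, `X` has no cohomology above `m - c - 1`, and this cannot reach degree `m` of the
  -- tensor product.
  obtain ⟨n, hn⟩ := ENat.ne_top_iff_exists.1
    (show ∑ i ∈ Finset.Icc (m - c) a, Module.length R (X.homology i) ≠ ⊤ from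
      WithTop.sum_ne_top.2 fun i _ => hX' i)
  induction n generalizing X with
  | zero =>
    have h1 : IsZero ((tensor φ X V).homology m) := by
      refine hX.isZero_homology_tensor φ (e := m - c - 1) (fun i hi => ?_) hc (by lia)
      by_cases h : a < i
      · exact ha i h
      · have := Module.length_eq_zero_iff.1 (Finset.sum_eq_zero_iff.1
          (hn.symm.trans Nat.cast_zero) i (Finset.mem_Icc.2 ⟨by lia, by lia⟩))
        exact ModuleCat.isZero_of_subsingleton _
    have := ModuleCat.subsingleton_of_isZero h1
    rw [Module.length_eq_zero]
    exact zero_le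
  | succ n ih =>
    let s := (Finset.Icc (m - c) a).filter fun i => Module.length R (X.homology i) ≠ 0
    have hs : s.Nonempty := by
      by_contra hs
      rw [Finset.not_nonempty_iff_eq_empty, Finset.filter_eq_empty_iff] at hs
      rw [Finset.sum_eq_zero fun i hi => not_not.1 (hs hi)] at hn
      exact absurd hn (by exact_mod_cast Nat.succ_ne_zero n)
    obtain ⟨e, hes, hmax⟩ := s.exists_max_image id hs
    obtain ⟨heI, he0⟩ := Finset.mem_filter.1 hes
    rw [Finset.mem_Icc] at heI
    have he : ∀ i, e < i → IsZero (X.homology i) := fun i hi => by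
      by_cases h : a < i
      · exact ha i h
      · have h1 : Module.length R (X.homology i) = 0 := by
          by_contra h2
          exact absurd (hmax i (Finset.mem_filter.2 ⟨Finset.mem_Icc.2 ⟨by lia, by lia⟩, h2⟩))
            (by simpa using hi)
        have := Module.length_eq_zero_iff.1 h1
        exact ModuleCat.isZero_of_subsingleton _
    obtain ⟨C, hC, hl, ht⟩ := hX.exists_reduction φ e he he0 (hX' e)
    -- The weights are left arbitrary: `t = 1` shows that the total length drops by one, and the
    -- lengths for `k ⊗ V` give the inductive estimate.
    have h1 : ∀ t : ℤ → ℕ∞, ∑ i ∈ Finset.Icc (m - c) a, Module.length R (X.homology i) * t i =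
        ∑ i ∈ Finset.Icc (m - c) a, Module.length R (C.homology i) * t i + t e := fun t => by
      simp_rw [hl, add_mul, Finset.sum_add_distrib, ite_mul, one_mul, zero_mul]
      rw [Finset.sum_ite_eq', if_pos (Finset.mem_Icc.2 heI)]
    have h2 := h1 fun _ => 1
    simp_rw [mul_one] at h2
    rw [h1]
    refine (ht V m).trans (add_le_add_left (ih hC (fun i hi => ?_) (fun i => ?_) ?_) _)
    · have h3 := hl i
      have := ModuleCat.subsingleton_of_isZero (ha i hi)
      rw [Module.length_eq_zero] at h3
      have := Module.length_eq_zero_iff.1 (add_eq_zero.1 h3.symm).1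
      exact ModuleCat.isZero_of_subsingleton _
    · intro h
      exact hX' i (by rw [hl, h, top_add])
    · rw [h2, Nat.cast_succ] at hn
      exact WithTop.add_right_cancel ENat.one_ne_top hn

end LengthBound

/-! ### Koszul complexes -/

section Koszul

variable {R S : Type u} [CommRing R] [CommRing S] (φ : R →+* S)

variable (S) in
/-- The ring as a complex concentrated in one degree. -/
abbrev unitAt (e : ℤ) : Cpx S :=
  (HomologicalComplex.single (ModuleCat.{u} S) (ComplexShape.up ℤ) e).obj (ModuleCat.of S S)

/-- The term of `koszulOne w` in cohomological degree `-1`. -/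
def koszulX₀ (w : S) : (koszulOne w).X (-1) ≅ ModuleCat.of S S :=
  HomologicalComplex.doubleXIso₀ _ _

/-- The term of `koszulOne w` in cohomological degree `0`. -/
def koszulX₁ (w : S) : (koszulOne w).X 0 ≅ ModuleCat.of S S :=
  HomologicalComplex.doubleXIso₁ _ _ (by decide)

theorem koszulOne_d (w : S) :
    (koszulOne w).d (-1) 0 = w • ((koszulX₀ w).hom ≫ (koszulX₁ w).inv) := by
  refine (HomologicalComplex.double_d _ _ (by decide)).trans ?_
  rw [Linear.smul_comp, Category.id_comp, Linear.comp_smul]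
  rfl

theorem koszulOne_d_zero (w : S) (k : ℤ) : (koszulOne w).d 0 k = 0 :=
  HomologicalComplex.double_d_eq_zero₀ _ _ _ _ (by decide)

theorem koszulOne_d_to (w : S) (k : ℤ) : (koszulOne w).d k (-1) = 0 :=
  HomologicalComplex.double_d_eq_zero₁ _ _ _ _ (by decide)

theorem isZero_koszulOne_X (w : S) (k : ℤ) (h₀ : k ≠ -1) (h₁ : k ≠ 0) :
    IsZero ((koszulOne w).X k) :=
  HomologicalComplex.isZero_double_X _ _ k h₀ h₁

/-- Maps out of `koszulOne w`. -/
def koszulOneDesc {w : S} {K : Cpx S} (a : ModuleCat.of S S ⟶ K.X (-1))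
    (b : ModuleCat.of S S ⟶ K.X 0) (h : a ≫ K.d (-1) 0 = w • b) (h' : b ≫ K.d 0 1 = 0) :
    koszulOne w ⟶ K :=
  HomologicalComplex.mkHomFromDouble _ (by decide) a b
    (by rw [h, Linear.smul_comp, Category.id_comp]) (fun k hk => by
      obtain rfl : (0 : ℤ) + 1 = k := hk
      exact h')

theorem koszulOneDesc_f₀ {w : S} {K : Cpx S} (a : ModuleCat.of S S ⟶ K.X (-1))
    (b : ModuleCat.of S S ⟶ K.X 0) (h : a ≫ K.d (-1) 0 = w • b) (h' : b ≫ K.d 0 1 = 0) :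
    (koszulOneDesc a b h h').f (-1) = (koszulX₀ w).hom ≫ a :=
  HomologicalComplex.mkHomFromDouble_f₀ _ _ _ _ _ _

theorem koszulOneDesc_f₁ {w : S} {K : Cpx S} (a : ModuleCat.of S S ⟶ K.X (-1))
    (b : ModuleCat.of S S ⟶ K.X 0) (h : a ≫ K.d (-1) 0 = w • b) (h' : b ≫ K.d 0 1 = 0) :
    (koszulOneDesc a b h h').f 0 = (koszulX₁ w).hom ≫ b :=
  HomologicalComplex.mkHomFromDouble_f₁ _ _ _ _ _ _

/-- The inclusion of the subcomplex `S` of `koszulOne w`. -/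
def koszulIncl (w : S) : unitAt S 0 ⟶ koszulOne w :=
  HomologicalComplex.mkHomFromSingle (koszulX₁ w).inv
    (fun k _ => by rw [koszulOne_d_zero, comp_zero])

/-- The projection of `koszulOne w` onto its quotient complex `S[1]`. -/
def koszulProj (w : S) : koszulOne w ⟶ unitAt S (-1) :=
  HomologicalComplex.mkHomToSingle (koszulX₀ w).hom
    (fun k _ => by rw [koszulOne_d_to, zero_comp])

theorem koszulIncl_f (w : S) : (koszulIncl w).f 0 =
    (HomologicalComplex.singleObjXSelf (ComplexShape.up ℤ) 0 (ModuleCat.of S S)).hom ≫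
      (koszulX₁ w).inv :=
  HomologicalComplex.mkHomFromSingle_f _ _

theorem koszulProj_f (w : S) : (koszulProj w).f (-1) = (koszulX₀ w).hom ≫
    (HomologicalComplex.singleObjXSelf (ComplexShape.up ℤ) (-1) (ModuleCat.of S S)).inv :=
  HomologicalComplex.mkHomToSingle_f _ _

theorem isZero_unitAt_X (e i : ℤ) (h : i ≠ e) : IsZero ((unitAt S e).X i) :=
  HomologicalComplex.isZero_single_obj_X _ _ _ _ h

/-- The short complex `S ⟶ koszulOne w ⟶ S[1]`. -/
def koszulSeq (w : S) : ShortComplex (Cpx S) :=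
  ShortComplex.mk (koszulIncl w) (koszulProj w)
    (HomologicalComplex.from_single_hom_ext
      ((isZero_unitAt_X (-1) 0 (by decide)).eq_of_tgt _ _))

theorem koszulSeq_split (w : S) : Nonempty (DegSplit (koszulSeq w)) := by
  have key (i : ℤ) : ∃ (r : (koszulOne w).X i ⟶ (unitAt S 0).X i)
      (s : (unitAt S (-1)).X i ⟶ (koszulOne w).X i), (koszulIncl w).f i ≫ r = 𝟙 _ ∧
      s ≫ (koszulProj w).f i = 𝟙 _ ∧ r ≫ (koszulIncl w).f i + (koszulProj w).f i ≫ s = 𝟙 _ := by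
    by_cases h₁ : i = 0
    · subst h₁
      have : IsIso ((koszulIncl w).f 0) := by
        rw [koszulIncl_f]; infer_instance
      refine ⟨inv ((koszulIncl w).f 0), 0, IsIso.hom_inv_id _,
        (isZero_unitAt_X (-1) 0 (by decide)).eq_of_src _ _, ?_⟩
      rw [comp_zero, add_zero]
      exact IsIso.inv_hom_id _
    · by_cases h₀ : i = -1
      · subst h₀
        have : IsIso ((koszulProj w).f (-1)) := by
          rw [koszulProj_f]; infer_instance
        refine ⟨0, inv ((koszulProj w).f (-1)),
          (isZero_unitAt_X 0 (-1) (by decide)).eq_of_src _ _, IsIso.inv_hom_id _, ?_⟩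
        rw [zero_comp, zero_add]
        exact IsIso.hom_inv_id _
      · exact ⟨0, 0, (isZero_unitAt_X 0 i h₁).eq_of_src _ _,
          (isZero_unitAt_X (-1) i h₀).eq_of_src _ _, (isZero_koszulOne_X w i h₀ h₁).eq_of_src _ _⟩
  choose r s h1 h2 h3 using key
  exact ⟨⟨r, s, h1, h2, h3⟩⟩

/-- The map of complexes `koszulOne w ⟶ koszulOne 1` which is multiplication by `w` in
cohomological degree `-1` and the identity in degree `0`. -/
def koszulScale (w : S) : koszulOne w ⟶ koszulOne 1 :=
  koszulOneDesc (w • (koszulX₀ 1).inv) (koszulX₁ 1).inv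
    (by rw [Linear.smul_comp, koszulOne_d, one_smul, Iso.inv_hom_id_assoc])
    (by rw [koszulOne_d_zero, comp_zero])

theorem koszulIncl_scale (w : S) : koszulIncl w ≫ koszulScale w = koszulIncl 1 :=
  HomologicalComplex.from_single_hom_ext (by
    rw [HomologicalComplex.comp_f, koszulIncl_f, koszulIncl_f, koszulScale, koszulOneDesc_f₁,
      Category.assoc, Iso.inv_hom_id_assoc])

theorem koszulScale_proj (w : S) : koszulScale w ≫ koszulProj 1 = koszulProj w ≫ (w • 𝟙 _) :=
  HomologicalComplex.to_single_hom_ext (by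
    rw [HomologicalComplex.comp_f, HomologicalComplex.comp_f, HomologicalComplex.smul_f_apply,
      HomologicalComplex.id_f, Linear.comp_smul, Category.comp_id, koszulProj_f, koszulProj_f,
      koszulScale, koszulOneDesc_f₀, Linear.comp_smul, Linear.smul_comp, Category.assoc,
      Iso.inv_hom_id_assoc])

/-- The map of short complexes which is multiplication by `w` on the quotient `S[1]`. -/
def koszulSeqMap (w : S) : koszulSeq w ⟶ koszulSeq (1 : S) where
  τ₁ := 𝟙 _
  τ₂ := koszulScale w
  τ₃ := w • 𝟙 _
  comm₁₂ := (Category.id_comp _).trans (koszulIncl_scale w).symm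
  comm₂₃ := koszulScale_proj w

/-- An element acting as zero on the cohomology of `V` up to homotopy doubles its length. -/
theorem length_homology_koszulOne {w : S} {V : Cpx S} (hw : w ∈ nullIdeal V) (i j : ℤ)
    (h : i + 1 = j) : Module.length S ((tens (koszulOne w) V).homology i) =
      Module.length S (V.homology i) + Module.length S (V.homology j) := by
  obtain ⟨σ⟩ := koszulSeq_split w
  obtain ⟨σ'⟩ := koszulSeq_split (1 : S)
  have hS := (σ.tens V).shortExact
  have hS' := (σ'.tens V).shortExact
  -- Naturality along `koszulSeqMap w` factors the connecting map for `w` through multiplication by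
  -- `w` on the cohomology of `S[1] ⊗ V`, which is zero. Hence the long exact sequence splits into
  -- short ones.
  have hδ (a b : ℤ) (hab : a + 1 = b) : hS.δ a b hab = 0 := by
    have h1 := HomologicalComplex.HomologySequence.δ_naturality
      ((tensorR V).mapShortComplex.map (koszulSeqMap w)) hS hS' a b hab
    have h2 : HomologicalComplex.homologyMap
        ((tensorR V).mapShortComplex.map (koszulSeqMap w)).τ₁ b = 𝟙 _ :=
      (congrArg (HomologicalComplex.homologyMap · b) ((tensorR V).map_id _)).trans
        (HomologicalComplex.homologyMap_id _ _)
    have h3 : HomologicalComplex.homologyMap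
        ((tensorR V).mapShortComplex.map (koszulSeqMap w)).τ₃ a = 0 := by
      obtain ⟨H⟩ := nullIdeal_le_tens_right (unitAt S (-1)) V hw
      refine Eq.trans ?_ ((H.homologyMap_eq a).trans (HomologicalComplex.homologyMap_zero _ _ a))
      refine congrArg (HomologicalComplex.homologyMap · a) ?_
      exact (smul_tmap V w (𝟙 (unitAt S (-1)))).trans
        (congrArg (w • ·) ((tensorR V).map_id (unitAt S (-1))))
    exact (Category.comp_id _).symm.trans ((congrArg (hS.δ a b hab ≫ ·) h2.symm).trans
      (h1.trans ((congrArg (· ≫ hS'.δ a b hab) h3).trans zero_comp)))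
  have hm : Mono (HomologicalComplex.homologyMap ((koszulSeq w).map (tensorR V)).f i) :=
    (hS.homology_exact₁ (i - 1) i (by simp)).mono_g (hδ _ _ _)
  have he : Epi (HomologicalComplex.homologyMap ((koszulSeq w).map (tensorR V)).g i) :=
    (hS.homology_exact₃ i j h).epi_f (hδ _ _ _)
  have h1 := length_eq_of_shortExact (T := ShortComplex.mk _ _ (by
    rw [← HomologicalComplex.homologyMap_comp, ShortComplex.zero,
      HomologicalComplex.homologyMap_zero])) ⟨hS.homology_exact₂ i⟩
  refine h1.trans (congrArg₂ (· + ·) (length_eq_of_iso ?_) (length_eq_of_iso ?_))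
  · exact (HomologicalComplex.homologyFunctor _ _ i).mapIso (unitTens V)
  · exact (HomologicalComplex.homologyFunctor _ _ i).mapIso
      (tensCongr (singleShift (ModuleCat.of S S) (-1)).symm (Iso.refl V) ≪≫ tensShift _ _ _) ≪≫
      homologyShift _ _ i j (by lia) ≪≫
      (HomologicalComplex.homologyFunctor _ _ j).mapIso (unitTens V)

theorem finite_homology_koszulOne [IsNoetherianRing S] (w : S) {V : Cpx S}
    (hV : ∀ i, Module.Finite S (V.homology i)) (i : ℤ) :
    Module.Finite S ((tens (koszulOne w) V).homology i) := by
  obtain ⟨σ⟩ := koszulSeq_split w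
  refine (ex₂ (σ.tens V).shortExact i).finite (finite_of_iso ?_ (hV i))
    (finite_of_iso ?_ (hV (i + 1)))
  · exact (HomologicalComplex.homologyFunctor _ _ i).mapIso (unitTens V).symm
  · exact ((HomologicalComplex.homologyFunctor _ _ i).mapIso
      (tensCongr (singleShift (ModuleCat.of S S) (-1)).symm (Iso.refl V) ≪≫ tensShift _ _ _) ≪≫
      homologyShift _ _ i (i + 1) (by lia) ≪≫
      (HomologicalComplex.homologyFunctor _ _ (i + 1)).mapIso (unitTens V)).symm

/-- The contracting homotopy is the identity of `S`, from cohomological degree `0` to degree `-1`.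
-/
theorem mem_nullIdeal_koszulOne (w : S) : w ∈ nullIdeal (koszulOne w) := by
  classical
  let H (i j : ℤ) : (koszulOne w).X i ⟶ (koszulOne w).X j :=
    if h : i = 0 ∧ j = -1 then
      eqToHom (by rw [h.1]) ≫ (koszulX₁ w).hom ≫ (koszulX₀ w).inv ≫ eqToHom (by rw [h.2])
    else 0
  have H0 : H 0 (-1) = (koszulX₁ w).hom ≫ (koszulX₀ w).inv := by
    simp [H]
  refine ⟨⟨H, fun i j hij => dif_neg ?_, fun i => ?_⟩⟩
  · rintro ⟨rfl, rfl⟩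
    exact hij (by simp)
  · rw [HomologicalComplex.zero_f, add_zero, HomologicalComplex.smul_f_apply,
      HomologicalComplex.id_f]
    by_cases h₀ : i = -1
    · subst h₀
      rw [dNext_eq H (show (ComplexShape.up ℤ).Rel (-1) 0 by simp),
        prevD_eq H (show (ComplexShape.up ℤ).Rel (-2) (-1) by simp), H0, koszulOne_d_to,
        comp_zero, add_zero, koszulOne_d, Linear.smul_comp, Category.assoc,
        Iso.inv_hom_id_assoc, Iso.hom_inv_id]
    · by_cases h₁ : i = 0
      · subst h₁
        rw [dNext_eq H (show (ComplexShape.up ℤ).Rel 0 1 by simp),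
          prevD_eq H (show (ComplexShape.up ℤ).Rel (-1) 0 by simp), H0, koszulOne_d_zero,
          zero_comp, zero_add, koszulOne_d, Linear.comp_smul, Category.assoc,
          Iso.inv_hom_id_assoc, Iso.hom_inv_id]
      · exact (isZero_koszulOne_X w i h₀ h₁).eq_of_src _ _

theorem mem_nullIdeal_koszul {w : S} {xs : List S} (h : w ∈ xs) : w ∈ nullIdeal (koszul xs) := by
  induction xs with
  | nil => simp at h
  | cons x xs ih =>
    rcases List.mem_cons.1 h with rfl | h
    · exact nullIdeal_le_tens_left _ _ (mem_nullIdeal_koszulOne w)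
    · exact nullIdeal_le_tens_right _ _ (ih h)

theorem projective_self : Projective (ModuleCat.of S S) :=
  (IsProjective.iff_projective (R := S) S).1 inferInstance

theorem ProjBdd.koszulOne (w : S) : ProjBdd (koszulOne w) := by
  obtain ⟨σ⟩ := koszulSeq_split w
  have := projective_self (S := S)
  exact ProjBdd.of_split σ (ProjBdd.single _ _) (ProjBdd.single _ _)

theorem ProjBdd.koszul (xs : List S) : ProjBdd (koszul xs) := by
  induction xs with
  | nil =>
    have := projective_self (S := S)
    exact ProjBdd.single _ _
  | cons x xs ih => exact (ProjBdd.koszulOne x).tens ih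

theorem finite_homology_koszul [IsNoetherianRing S] (xs : List S) {V : Cpx S}
    (hV : ∀ i, Module.Finite S (V.homology i)) (i : ℤ) :
    Module.Finite S ((tens (koszul xs) V).homology i) := by
  induction xs generalizing i with
  | nil =>
    exact finite_of_iso
      ((HomologicalComplex.homologyFunctor _ _ i).mapIso (unitTens V).symm) (hV i)
  | cons x xs ih =>
    exact finite_of_iso ((HomologicalComplex.homologyFunctor _ _ i).mapIso
      (tensAssoc (LocalHomInvariants.koszulOne x) (LocalHomInvariants.koszul xs) V).symm)
      (finite_homology_koszulOne x ih i)

/-- The Koszul complex of a concatenation. -/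
def koszulAppend (xs ys : List S) : koszul (xs ++ ys) ≅ tens (koszul xs) (koszul ys) :=
  match xs with
  | [] => (unitTens (koszul ys)).symm
  | x :: xs => tensCongr (Iso.refl (koszulOne x)) (koszulAppend xs ys) ≪≫
      (tensAssoc (koszulOne x) (koszul xs) (koszul ys)).symm

end Koszul

/-! ### Koszul complexes under extension of scalars -/

section KoszulExtension

variable {R S : Type u} [CommRing R] [CommRing S] (φ : R →+* S)

/-- The unit comparison for extension of scalars. -/
def extUnit : ModuleCat.of S S ≅ (ModuleCat.extendScalars.{u, u, u} φ).obj (ModuleCat.of R R) :=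
  Functor.Monoidal.εIso (ModuleCat.extendScalars.{u, u, u} φ)

/-- The comparison of Koszul complexes under extension of scalars. -/
def koszulOneExtHom (x : R) : koszulOne (φ x) ⟶ (extC φ).obj (koszulOne x) :=
  koszulOneDesc ((extUnit φ).hom ≫ (ModuleCat.extendScalars φ).map (koszulX₀ x).inv)
    ((extUnit φ).hom ≫ (ModuleCat.extendScalars φ).map (koszulX₁ x).inv)
    (by
      refine (Category.assoc _ _ _).trans ?_
      refine (congrArg ((extUnit φ).hom ≫ ·)
        ((ModuleCat.extendScalars φ).map_comp _ _).symm).trans ?_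
      rw [koszulOne_d, Linear.comp_smul, Iso.inv_hom_id_assoc, extendScalars_map_smul]
      exact Linear.comp_smul _ _ _ _ _ _)
    (by
      refine (Category.assoc _ _ _).trans ?_
      refine (congrArg ((extUnit φ).hom ≫ ·)
        ((ModuleCat.extendScalars φ).map_comp _ _).symm).trans ?_
      rw [koszulOne_d_zero, comp_zero, Functor.map_zero]
      exact comp_zero)

theorem isIso_koszulOneExtHom (x : R) : IsIso (koszulOneExtHom φ x) := by
  have (i : ℤ) : IsIso ((koszulOneExtHom φ x).f i) := by
    by_cases h₀ : i = -1
    · subst h₀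
      rw [koszulOneExtHom, koszulOneDesc_f₀]
      exact (koszulX₀ (φ x) ≪≫ extUnit φ ≪≫
          (ModuleCat.extendScalars φ).mapIso (koszulX₀ x).symm).isIso_hom
    · by_cases h₁ : i = 0
      · subst h₁
        rw [koszulOneExtHom, koszulOneDesc_f₁]
        exact (koszulX₁ (φ x) ≪≫ extUnit φ ≪≫
          (ModuleCat.extendScalars φ).mapIso (koszulX₁ x).symm).isIso_hom
      · exact ⟨0, (isZero_koszulOne_X _ i h₀ h₁).eq_of_src _ _,
          ((ModuleCat.extendScalars φ).map_isZero (isZero_koszulOne_X x i h₀ h₁)).eq_of_src _ _⟩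
  exact HomologicalComplex.Hom.isIso_of_components _

/-- Koszul complexes commute with extension of scalars. -/
def koszulExt (xs : List R) : koszul (xs.map φ) ≅ (extC φ).obj (koszul xs) :=
  match xs with
  | [] => (extCUnit φ).symm
  | x :: xs =>
    have := isIso_koszulOneExtHom φ x
    tensCongr (asIso (koszulOneExtHom φ x)) (koszulExt xs) ≪≫ extTens φ (koszulOne x) (koszul xs)

end KoszulExtension

/-! ### The maximal ideal acts null-homotopically on a resolution of the residue field -/

section ResidueField

open IsLocalRing

variable {R : Type u} [CommRing R]

/-- This is the uniqueness that accompanies `exists_lift`. -/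
theorem homotopy_of_comp_quasiIso {X P Y : Cpx R} (hX : ProjBdd X) (π : P ⟶ Y) [QuasiIso π]
    {f g : X ⟶ P} (h : Homotopy (f ≫ π) (g ≫ π)) : Nonempty (Homotopy f g) := by
  have := hX.isKProjective
  let := HasDerivedCategory.standard (ModuleCat.{u} R)
  have hq : IsIso (DerivedCategory.Q.map π) := inferInstance
  have hq : IsIso (DerivedCategory.Qh.map ((HomotopyCategory.quotient _ _).map π)) := hq
  refine ⟨HomotopyCategory.homotopyOfEq _ _
    ((CochainComplex.IsKProjective.Qh_map_bijective X _).injective ?_)⟩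
  rw [← cancel_mono (DerivedCategory.Qh.map ((HomotopyCategory.quotient _ _).map π)),
    ← Functor.map_comp, ← Functor.map_comp, ← Functor.map_comp, ← Functor.map_comp]
  exact congrArg (DerivedCategory.Qh.map ·) (HomotopyCategory.eq_of_homotopy _ _ h)

theorem smul_id_residueCpx [IsLocalRing R] {r : R} (hr : r ∈ maximalIdeal R) :
    r • 𝟙 (residueCpx R) = 0 := by
  have h1 : r • 𝟙 (ModuleCat.of R (ResidueField R)) = 0 := by
    ext x
    obtain ⟨y, rfl⟩ := Ideal.Quotient.mk_surjective x
    exact Ideal.Quotient.eq_zero_iff_mem.2 (Ideal.mul_mem_right _ _ hr)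
  refine HomologicalComplex.from_single_hom_ext ?_
  rw [HomologicalComplex.smul_f_apply, HomologicalComplex.id_f, HomologicalComplex.zero_f]
  have h2 := congrArg (fun t =>
    (HomologicalComplex.singleObjXSelf (ComplexShape.up ℤ) 0 (ModuleCat.of R (ResidueField R))).hom ≫
      t ≫ (HomologicalComplex.singleObjXSelf (ComplexShape.up ℤ) 0
        (ModuleCat.of R (ResidueField R))).inv) h1
  simp only [zero_comp, comp_zero, Linear.smul_comp, Linear.comp_smul, Category.id_comp,
    Iso.hom_inv_id] at h2
  exact h2

/-- Multiplication by `r` is zero on `k`, and lifts to a resolution are unique up to homotopy.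
Null-homotopy, unlike annihilation of cohomology, passes to tensor products. -/
theorem maximalIdeal_le_nullIdeal [IsLocalRing R] :
    maximalIdeal R ≤ nullIdeal (resField R) := by
  intro r hr
  obtain ⟨π, hπ⟩ := projRes_spec (residueCpx R) (residueCpx_bounded R)
  have := hπ.quasiIso
  refine homotopy_of_comp_quasiIso hπ.projBdd π (Homotopy.ofEq ?_)
  rw [Linear.smul_comp, Category.id_comp, zero_comp, ← Category.comp_id π, ← Linear.comp_smul,
    smul_id_residueCpx hr, comp_zero]

end ResidueField

/-! ### Complexes with finite cohomology -/

section FiniteHomology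

open IsLocalRing

variable {R S : Type u} [CommRing R] [CommRing S] (φ : R →+* S)

/-- Complexes with finite cohomology modules, vanishing in high cohomological degrees. -/
structure FinBdd (V : Cpx S) : Prop where
  finite : ∀ i, Module.Finite S (V.homology i)
  bounded : ∃ c : ℤ, ∀ i, c < i → IsZero (V.homology i)

theorem InDPlusF.finBdd {M : Cpx S} (hM : InDPlusF M) : FinBdd M where
  finite i := by
    obtain ⟨n, rfl⟩ : ∃ n, i = -n := ⟨-i, (neg_neg i).symm⟩
    exact hM.finite n
  bounded := by
    obtain ⟨a, ha⟩ := hM.bounded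
    refine ⟨-a, fun i hi => ?_⟩
    obtain ⟨n, rfl⟩ : ∃ n, i = -n := ⟨-i, (neg_neg i).symm⟩
    have := ha n (by lia)
    exact ModuleCat.isZero_of_subsingleton (H n M)

theorem FinBdd.of_quasiIso {X Y : Cpx S} (f : X ⟶ Y) [QuasiIso f] (hY : FinBdd Y) : FinBdd X where
  finite i := finite_of_iso (asIso (HomologicalComplex.homologyMap f i)).symm (hY.finite i)
  bounded := by
    obtain ⟨c, hc⟩ := hY.bounded
    exact ⟨c, fun i hi => (hc i hi).of_iso (asIso (HomologicalComplex.homologyMap f i))⟩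

theorem FinBdd.projRes {L : Cpx S} (hL : HomologyBoundedBelow L) (h : FinBdd L) :
    FinBdd (projRes L hL) := by
  obtain ⟨π, hπ⟩ := projRes_spec L hL
  have := hπ.quasiIso
  exact h.of_quasiIso π

theorem FinBdd.tensor [IsNoetherianRing R] [IsNoetherianRing S] {X : Cpx R} (hX : ProjBdd X)
    (h : FinBdd X) {V : Cpx S} (hV : FinBdd V) : FinBdd (tensor φ X V) := by
  obtain ⟨a, ha⟩ := h.bounded
  obtain ⟨c, hc⟩ := hV.bounded
  exact ⟨hX.finite_homology_tensor φ hc hV.finite h.finite,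
    a + c, fun i hi => hX.isZero_homology_tensor φ ha hc hi⟩

theorem FinBdd.koszul [IsNoetherianRing S] (xs : List S) {V : Cpx S} (hV : FinBdd V) :
    FinBdd (tens (koszul xs) V) := by
  refine ⟨fun i => finite_homology_koszul xs hV.finite i, ?_⟩
  obtain ⟨b, hb⟩ := (ProjBdd.koszul xs).bounded
  obtain ⟨c, hc⟩ := hV.bounded
  exact ⟨b + c, fun i hi =>
    isZero_homology_tens (ProjBdd.koszul xs).projective hb hc hi⟩

theorem FinBdd.residueCpx [IsLocalRing S] : FinBdd (residueCpx S) where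
  finite i := by
    by_cases h : i = 0
    · subst h
      exact finite_of_iso (HomologicalComplex.singleObjHomologySelfIso (ComplexShape.up ℤ) 0
        (ModuleCat.of S (ResidueField S))).symm
        (inferInstanceAs (Module.Finite S (S ⧸ maximalIdeal S)))
    · have h0 : IsZero ((LocalHomInvariants.residueCpx S).homology i) :=
        HomologicalComplex.isZero_single_obj_homology _ _ _ _ h
      have := ModuleCat.subsingleton_of_isZero h0
      infer_instance
  bounded := ⟨0, fun i hi => HomologicalComplex.isZero_single_obj_homology _ _ _ _ (by lia)⟩

theorem FinBdd.resField [IsLocalRing S] : FinBdd (resField S) := FinBdd.residueCpx.projRes _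

theorem ProjBdd.projRes (L : Cpx S) (hL : HomologyBoundedBelow L) : ProjBdd (projRes L hL) :=
  (projRes_spec L hL).choose_spec.projBdd

/-- Such a module is a quotient of a finite power of the residue field. -/
theorem length_ne_top_of_smul_eq_zero [IsLocalRing S] {M : Type u} [AddCommGroup M] [Module S M]
    [Module.Finite S M] (h : ∀ s ∈ maximalIdeal S, ∀ x : M, s • x = 0) :
    Module.length S M ≠ ⊤ := by
  obtain ⟨r, g, hg⟩ := Module.Finite.exists_fin (R := S) (M := M)
  let f (i : Fin r) : (S ⧸ maximalIdeal S) →ₗ[S] M :=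
    Submodule.liftQ (maximalIdeal S) (LinearMap.toSpanSingleton S M (g i)) fun s hs => h s hs _
  have hf : Function.Surjective (LinearMap.lsum S (fun _ : Fin r => S ⧸ maximalIdeal S) S f) := by
    rw [← LinearMap.range_eq_top, ← top_le_iff, ← hg, Submodule.span_le]
    rintro _ ⟨i, rfl⟩
    exact ⟨Pi.single i (Submodule.Quotient.mk 1),
      (LinearMap.lsum_piSingle (S := S) (f := f) (i := i) ..).trans (one_smul S (g i))⟩
  refine ne_top_of_le_ne_top ?_ (Module.length_le_of_surjective _ hf)
  rw [Module.length_pi]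
  have h1 : Module.length S (S ⧸ maximalIdeal S) = 1 := length_residueField
  rw [h1]
  simp

theorem FinBdd.length_ne_top [IsLocalRing S] {V : Cpx S} (hV : FinBdd V)
    (h : maximalIdeal S ≤ nullIdeal V) (i : ℤ) : Module.length S (V.homology i) ≠ ⊤ := by
  have := hV.finite i
  exact length_ne_top_of_smul_eq_zero fun s hs x => smul_homology_eq_zero (h hs) i x

end FiniteHomology

/-! ### Minimal generators of the maximal ideal modulo the base -/

section MinimalGenerators

open IsLocalRing

variable {R S : Type u} [CommRing R] [IsLocalRing R] [CommRing S] [IsLocalRing S]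
  (φ : R →+* S)

theorem IsMinGen.maximalIdeal_le {y : List S} (hy : IsMinGen φ y) :
    maximalIdeal S ≤ (maximalIdeal R).map φ ⊔ Ideal.span {a | a ∈ y} := by
  intro x hx
  rw [sup_comm, ← Ideal.mem_quotient_iff_mem_sup, Ideal.map_span, hy.span_eq]
  exact Ideal.mem_map_of_mem _ hx

theorem map_maximalIdeal_le [IsLocalHom φ] : (maximalIdeal R).map φ ≤ maximalIdeal S :=
  ((local_hom_TFAE φ).out 0 2).1 ‹IsLocalHom φ›

theorem IsMinGen.mem_maximalIdeal [IsLocalHom φ] {y : List S} (hy : IsMinGen φ y) {a : S}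
    (ha : a ∈ y) : a ∈ maximalIdeal S := by
  have h1 : Ideal.Quotient.mk ((maximalIdeal R).map φ) a ∈ maxIdealMod φ := by
    rw [← hy.span_eq]
    exact Ideal.subset_span ⟨a, ha, rfl⟩
  rw [maxIdealMod, Ideal.mem_quotient_iff_mem_sup, sup_eq_left.2 (map_maximalIdeal_le φ)] at h1
  exact h1

/-- For the concatenated list of a composite homomorphism this gives the length inequality needed to
compare Koszul complexes. -/
theorem edim_le_length [IsLocalHom φ] {w : List S} (hw : ∀ a ∈ w, a ∈ maximalIdeal S)
    (h : maximalIdeal S ≤ (maximalIdeal R).map φ ⊔ Ideal.span {a | a ∈ w}) :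
    edim φ ≤ w.length := by
  classical
  let q := Ideal.Quotient.mk ((maximalIdeal R).map φ)
  have h1 : maxIdealMod φ = Ideal.span (q '' {a | a ∈ w}) := by
    rw [← Ideal.map_span]
    refine le_antisymm ?_ (Ideal.map_mono (Ideal.span_le.2 hw))
    refine (Ideal.map_mono h).trans ?_
    rw [Ideal.map_sup, Ideal.map_quotient_self, bot_sup_eq]
  have h2 : (q '' {a | a ∈ w}) = ((w.map q).toFinset : Set _) := by
    ext a; simp
  rw [edim, h1, h2]
  refine (Submodule.spanFinrank_span_le_ncard_of_finite (Finset.finite_toSet _)).trans ?_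
  rw [Set.ncard_coe_finset]
  exact (List.toFinset_card_le _).trans (by simp)

theorem minGen_spec [IsNoetherianRing S] : IsMinGen φ (minGen φ) := (exists_isMinGen φ).choose_spec

end MinimalGenerators

/-! ### The operator on length functions induced by a Koszul factor -/

section Doubling

/-- The operator `f ↦ (i ↦ f i + f (i + 1))`. -/
def doubling (f : ℤ → ℕ∞) (i : ℤ) : ℕ∞ := f i + f (i + 1)

theorem le_iterate_doubling (f : ℤ → ℕ∞) (n : ℕ) : f ≤ doubling^[n] f := by
  induction n with
  | zero => exact le_rfl
  | succ n ih =>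
    rw [Function.iterate_succ_apply']
    exact ih.trans fun i => le_self_add

/-- Descending induction from `N`: once the values at `i + 1` agree and are finite, they cancel. -/
theorem doubling_injective {f g : ℤ → ℕ∞} {N : ℤ} (hf : ∀ i, N < i → f i = 0)
    (hg : ∀ i, N < i → g i = 0) (hfin : ∀ i, f i ≠ ⊤) (h : doubling f = doubling g) : f = g := by
  have key (k : ℕ) : ∀ i, N - k < i → f i = g i := by
    induction k with
    | zero => exact fun i hi => by rw [hf i (by simpa using hi), hg i (by simpa using hi)]
    | succ k ih =>
      intro i hi
      have h1 : f i + f (i + 1) = g i + g (i + 1) := congrFun h i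
      rw [← ih (i + 1) (by push_cast at hi; lia)] at h1
      exact WithTop.add_right_cancel (hfin (i + 1)) h1
  funext i
  exact key (N - i + 1).toNat i (by lia)

theorem doubling_iterate_injective {f g : ℤ → ℕ∞} {N : ℤ} (hf : ∀ i, N < i → f i = 0)
    (hg : ∀ i, N < i → g i = 0) (hfin : ∀ i, f i ≠ ⊤) (n : ℕ)
    (h : doubling^[n] f = doubling^[n] g) : f = g := by
  induction n generalizing f g with
  | zero => exact h
  | succ n ih =>
    refine doubling_injective hf hg hfin (ih (fun i hi => ?_) (fun i hi => ?_) (fun i => ?_) h)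
    · rw [doubling, hf i hi, hf _ (by lia), add_zero]
    · rw [doubling, hg i hi, hg _ (by lia), add_zero]
    · exact WithTop.add_ne_top.2 ⟨hfin _, hfin _⟩

theorem doubling_iterate_vanishing {f : ℤ → ℕ∞} {N : ℤ} (hf : ∀ i, N < i → f i = 0) (n : ℕ) :
    ∀ i, N < i → doubling^[n] f i = 0 := by
  induction n generalizing f with
  | zero => exact hf
  | succ n ih => exact ih fun i hi => by rw [doubling, hf i hi, hf _ (by lia), add_zero]

/-- Cancelling `n` doublings leaves `g` equal to the `(m - n)`-fold doubling of `f`, which dominates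
`f`. -/
theorem le_of_doubling_iterate_eq {f g : ℤ → ℕ∞} {N : ℤ} (hf : ∀ i, N < i → f i = 0)
    (hg : ∀ i, N < i → g i = 0) (hfin : ∀ i, g i ≠ ⊤) {m n : ℕ} (hmn : n ≤ m)
    (h : doubling^[m] f = doubling^[n] g) : f ≤ g := by
  obtain ⟨k, rfl⟩ := Nat.exists_eq_add_of_le hmn
  rw [Function.iterate_add_apply] at h
  rw [doubling_iterate_injective hg (doubling_iterate_vanishing hf k) hfin n h.symm]
  exact le_iterate_doubling f k

end Doubling

/-! ### Comparison of Koszul complexes by length -/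

section KoszulLength

variable {S : Type u} [CommRing S]

/-- The lengths of the cohomology modules. -/
def lengths (V : Cpx S) (i : ℤ) : ℕ∞ := Module.length S (V.homology i)

theorem lengths_congr {V W : Cpx S} (e : V ≅ W) : lengths V = lengths W :=
  funext fun i => length_eq_of_iso ((HomologicalComplex.homologyFunctor _ _ i).mapIso e)

/-- Each factor doubles once, since a null-homotopy on `V` persists on `K[xs] ⊗ V`. -/
theorem lengths_koszul {V : Cpx S} (xs : List S) (h : ∀ x ∈ xs, x ∈ nullIdeal V) :
    lengths (tens (koszul xs) V) = doubling^[xs.length] (lengths V) := by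
  induction xs with
  | nil => exact lengths_congr (unitTens V)
  | cons x xs ih =>
    rw [List.length_cons, Function.iterate_succ_apply',
      ← ih fun y hy => h y (List.mem_cons_of_mem x hy)]
    refine (lengths_congr (tensAssoc (koszulOne x) (koszul xs) V)).trans ?_
    exact funext fun i => length_homology_koszulOne
      (nullIdeal_le_tens_right _ _ (h x List.mem_cons_self)) i (i + 1) rfl

/-- Moving a factor of a tensor product to the front. -/
def tensLeftComm (A B C : Cpx S) : tens A (tens B C) ≅ tens B (tens A C) :=
  (tensAssoc A B C).symm ≪≫ tensCongr (tensComm A B) (Iso.refl C) ≪≫ tensAssoc B A C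

/-- Regrouping five factors of a tensor product. -/
def tensRegroup (A B C Y M : Cpx S) : tens (tens A (tens B C)) (tens Y M) ≅
    tens (tens B Y) (tens A (tens C M)) :=
  tensAssoc A (tens B C) (tens Y M) ≪≫ tensCongr (Iso.refl A)
    (tensAssoc B C (tens Y M) ≪≫ tensCongr (Iso.refl B) (tensLeftComm C Y M) ≪≫
      (tensAssoc B Y (tens C M)).symm) ≪≫ tensLeftComm A (tens B Y) (tens C M)

theorem FinBdd.exists_lengths_eq_zero {V : Cpx S} (hV : FinBdd V) :
    ∃ N : ℤ, ∀ i, N < i → lengths V i = 0 := by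
  obtain ⟨c, hc⟩ := hV.bounded
  refine ⟨c, fun i hi => ?_⟩
  have := ModuleCat.subsingleton_of_isZero (hc i hi)
  exact Module.length_eq_zero

/-- Comparison of Koszul complexes on two sequences, the first of which is not longer. -/
theorem lengths_koszul_le [IsLocalRing S] [IsNoetherianRing S] {W : Cpx S} (hW : FinBdd W)
    {z w : List S} (hz : ∀ a ∈ z, a ∈ IsLocalRing.maximalIdeal S)
    (hw : ∀ a ∈ w, a ∈ IsLocalRing.maximalIdeal S) (hzw : z.length ≤ w.length)
    (hz' : IsLocalRing.maximalIdeal S ≤ nullIdeal (tens (koszul z) W))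
    (hw' : IsLocalRing.maximalIdeal S ≤ nullIdeal (tens (koszul w) W)) :
    lengths (tens (koszul z) W) ≤ lengths (tens (koszul w) W) := by
  obtain ⟨N, hN⟩ := (FinBdd.koszul z hW).exists_lengths_eq_zero
  obtain ⟨N', hN'⟩ := (FinBdd.koszul w hW).exists_lengths_eq_zero
  refine le_of_doubling_iterate_eq (N := max N N')
    (fun i hi => hN i (lt_of_le_of_lt (le_max_left _ _) hi))
    (fun i hi => hN' i (lt_of_le_of_lt (le_max_right _ _) hi))
    (FinBdd.length_ne_top (FinBdd.koszul w hW) hw') hzw ?_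
  -- Both sides are the lengths for `K[z] ⊗ K[w] ⊗ W`, with the two Koszul factors added in opposite
  -- orders.
  rw [← lengths_koszul w fun a ha => hz' (hw a ha), ← lengths_koszul z fun a ha => hw' (hz a ha)]
  exact lengths_congr (tensLeftComm _ _ _)

theorem span_le_nullIdeal (y : List S) : Ideal.span {a | a ∈ y} ≤ nullIdeal (koszul y) :=
  Ideal.span_le.2 fun _ ha => mem_nullIdeal_koszul ha

theorem map_maximalIdeal_le_nullIdeal {R : Type u} [CommRing R] [IsLocalRing R] (φ : R →+* S) :
    (IsLocalRing.maximalIdeal R).map φ ≤ nullIdeal ((extC φ).obj (resField R)) :=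
  (Ideal.map_mono maximalIdeal_le_nullIdeal).trans (map_nullIdeal_le_extC φ _)

end KoszulLength

/-! ### Betti numbers and the convolution bound -/

section Betti

open IsLocalRing

variable {R' R S : Type u} [CommRing R'] [IsLocalRing R'] [CommRing R] [IsLocalRing R]
  [CommRing S] [IsLocalRing S] [IsNoetherianRing S] (ρ : R' →+* R) (φ : R →+* S)

theorem betti_eq (M : Cpx S) (i : ℤ) :
    betti φ M (-i) =
      Module.length S ((tensor φ (resField R) (tens (koszul (minGen φ)) M)).homology i) := by
  obtain ⟨n, rfl⟩ : ∃ n, i = -n := ⟨-i, (neg_neg i).symm⟩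
  rw [neg_neg]
  rfl

/-- The maximal ideal of `S` is contained in the sum of the extension of that of `R`, null-homotopic
on the resolution of `k`, and the ideal generated by `minGen φ`, null-homotopic on the Koszul
factor. It thus annihilates the finite module being measured. -/
theorem FinBdd.betti_ne_top [IsNoetherianRing R] {M : Cpx S} (hM : FinBdd M) (n : ℤ) :
    betti φ M n ≠ ⊤ := by
  obtain ⟨i, rfl⟩ : ∃ i, n = -i := ⟨-n, (neg_neg n).symm⟩
  rw [betti_eq]
  refine FinBdd.length_ne_top (FinBdd.tensor φ (ProjBdd.projRes _ _) FinBdd.resField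
    (FinBdd.koszul _ hM)) ?_ i
  refine (minGen_spec φ).maximalIdeal_le.trans (sup_le ?_ ?_)
  · exact (map_maximalIdeal_le_nullIdeal φ).trans (nullIdeal_le_tens_left _ _)
  · exact (span_le_nullIdeal _).trans
      ((nullIdeal_le_tens_left _ _).trans (nullIdeal_le_tens_right _ _))

/-- The Betti numbers of a derived tensor product are bounded by a convolution. -/
theorem betti_derivedTensor_le [IsNoetherianRing R'] [IsNoetherianRing R] [IsLocalHom ρ]
    [IsLocalHom φ] (L : Cpx R)
    (hL : HomologyBoundedBelow L) (hL' : FinBdd L) (M : Cpx S) (hM : FinBdd M) :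
    ∃ p q : ℤ, ∀ n : ℤ, betti (φ.comp ρ) (derivedTensor φ L hL M) n ≤
      ∑ i ∈ Finset.Icc p (n - q), betti ρ L i * betti φ M (n - i) := by
  let P := projRes L hL
  let A := (extC ρ).obj (resField R')
  let x := minGen ρ
  let y := minGen φ
  let z := minGen (φ.comp ρ)
  let w := x.map φ ++ y
  let X := tens A (tens (koszul x) P)
  let W := tens ((extC (φ.comp ρ)).obj (resField R')) (tens ((extC φ).obj P) M)
  let V := tens (koszul y) M
  have hA : ProjBdd A := (ProjBdd.projRes _ _).extC ρ
  have hX : ProjBdd X := hA.tens ((ProjBdd.koszul x).tens (ProjBdd.projRes _ _))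
  have hP : FinBdd P := hL'.projRes hL
  have hXF : FinBdd X := FinBdd.tensor ρ (ProjBdd.projRes _ _) FinBdd.resField (hP.koszul x)
  have hWF : FinBdd W := FinBdd.tensor (φ.comp ρ) (ProjBdd.projRes _ _) FinBdd.resField
    (FinBdd.tensor φ (ProjBdd.projRes _ _) hP hM)
  have hV : FinBdd V := hM.koszul y
  -- `X` is built from the resolution `P` so that it is a complex of projectives, whereas the Betti
  -- numbers use `L` itself; the factor in front of `P` consists of projectives, so the lengths
  -- agree.
  have hXl (i : ℤ) : Module.length R (X.homology i) = betti ρ L (-i) := by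
    obtain ⟨π, hπ⟩ := projRes_spec L hL
    have := hπ.quasiIso
    rw [betti_eq]
    refine (congrFun (lengths_congr (tensAssoc A (koszul x) P)) i).symm.trans ?_
    exact (length_homology_tens_of_quasiIso π (hA.tens (ProjBdd.koszul x)) i).trans
      (congrFun (lengths_congr (tensAssoc A (koszul x) L)) i)
  have hm : (maximalIdeal R').map (φ.comp ρ) ≤ nullIdeal W :=
    (map_maximalIdeal_le_nullIdeal (φ.comp ρ)).trans (nullIdeal_le_tens_left _ _)
  have hz := minGen_spec (φ.comp ρ)
  have hsup : maximalIdeal S ≤ (maximalIdeal R').map (φ.comp ρ) ⊔ Ideal.span {a | a ∈ w} := by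
    refine (minGen_spec φ).maximalIdeal_le.trans (sup_le ?_ ?_)
    · refine (Ideal.map_mono (minGen_spec ρ).maximalIdeal_le).trans ?_
      rw [Ideal.map_sup, Ideal.map_map, Ideal.map_span]
      refine sup_le_sup le_rfl (Ideal.span_mono ?_)
      rintro _ ⟨a, ha, rfl⟩
      exact List.mem_append_left _ (List.mem_map_of_mem ha)
    · exact le_sup_of_le_right (Ideal.span_mono fun a ha => List.mem_append_right _ ha)
  have hw (a : S) (ha : a ∈ w) : a ∈ maximalIdeal S := by
    rcases List.mem_append.1 ha with ha | ha
    · obtain ⟨b, hb, rfl⟩ := List.mem_map.1 ha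
      exact map_maximalIdeal_le φ (Ideal.mem_map_of_mem _ ((minGen_spec ρ).mem_maximalIdeal ρ hb))
    · exact (minGen_spec φ).mem_maximalIdeal φ ha
  have : IsLocalHom (φ.comp ρ) := inferInstance
  -- The list `w` generates the maximal ideal modulo the base but need not be minimal, which is why
  -- only an inequality holds.
  have h1 : lengths (tens (koszul z) W) ≤ lengths (tens (koszul w) W) := by
    refine lengths_koszul_le hWF (fun a ha => hz.mem_maximalIdeal _ ha) hw ?_ ?_ ?_
    · rw [hz.length_eq]
      exact edim_le_length _ hw hsup
    · exact hz.maximalIdeal_le.trans (sup_le (hm.trans (nullIdeal_le_tens_right _ _))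
        ((span_le_nullIdeal z).trans (nullIdeal_le_tens_left _ _)))
    · exact hsup.trans (sup_le (hm.trans (nullIdeal_le_tens_right _ _))
        ((span_le_nullIdeal w).trans (nullIdeal_le_tens_left _ _)))
  -- Extending `X` to `S` turns `K[x]` into the Koszul complex on the images of `x`; it is then
  -- gathered with `K[y]` into `K[w]`.
  have e : tensor φ X V ≅ tens (koszul w) W :=
    tensCongr ((extTens φ A (tens (koszul x) P)).symm ≪≫
      tensCongr (extCComp ρ φ (resField R')).symm
        ((extTens φ (koszul x) P).symm ≪≫ tensCongr (koszulExt φ x).symm (Iso.refl _)))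
      (Iso.refl V) ≪≫ tensRegroup _ _ _ _ _ ≪≫
    tensCongr (koszulAppend (x.map φ) y).symm (Iso.refl W)
  obtain ⟨a, ha⟩ := hXF.bounded
  obtain ⟨c, hc⟩ := hV.bounded
  refine ⟨-a, -c, fun n => ?_⟩
  have h2 : betti (φ.comp ρ) (derivedTensor φ L hL M) n = lengths (tens (koszul z) W) (-n) :=
    congrFun (lengths_congr (tensLeftComm _ (koszul z) _)) (-n)
  rw [h2]
  refine (h1 (-n)).trans ((congrFun (lengths_congr e) (-n)).symm.le.trans ?_)
  refine (hX.length_homology_tensor_le φ hc ha fun i => ?_).trans (le_of_eq ?_)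
  · rw [hXl]
    exact hL'.betti_ne_top ρ _
  -- The substitution `i ↦ -i` passes from cohomological to homological indexing.
  · refine Finset.sum_nbij' (fun i => -i) (fun i => -i) ?_ ?_ ?_ ?_ ?_
    · intro i hi
      rw [Finset.mem_Icc] at hi ⊢
      lia
    · intro i hi
      rw [Finset.mem_Icc] at hi ⊢
      lia
    · exact fun i _ => neg_neg i
    · exact fun i _ => neg_neg i
    · intro i _
      rw [hXl, show n - -i = -(-n - i) by ring, betti_eq φ M (-n - i)]

end Betti

/-! ### Growth of convolutions -/

section Convolution

variable {F G U : ℤ → ℝ≥0∞} {p q : ℤ}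

/-- Beyond some `N` the limsup gives the bound with constant `1`; the finitely many finite terms
from `p` to `N` are absorbed into `C`. Integer powers are used because `p` may be negative. -/
theorem exists_zpow_bound (hF : ∀ i, F i ≠ ⊤) (p : ℤ) {c : ℝ≥0∞} (hc : c ≠ ⊤)
    (h : limsup (fun n : ℕ => F n ^ (1 / (n : ℝ))) atTop < c) :
    ∃ C : ℝ≥0∞, C ≠ ⊤ ∧ ∀ i, p ≤ i → F i ≤ C * c ^ i := by
  have hc0 : c ≠ 0 := (bot_le.trans_lt h).ne'
  obtain ⟨N, hN⟩ := eventually_atTop.1 ((eventually_lt_of_limsup_lt h).and (eventually_ge_atTop 1))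
  refine ⟨1 + ∑ i ∈ Finset.Icc p N, F i * c ^ (-i), ?_, fun i hi => ?_⟩
  · refine ENNReal.add_ne_top.2 ⟨ENNReal.one_ne_top, ENNReal.sum_ne_top.2 fun i _ => ?_⟩
    exact ENNReal.mul_ne_top (hF i) (ENNReal.zpow_ne_top hc0 hc _)
  · rw [add_mul, one_mul]
    by_cases h1 : i ≤ N
    · refine le_add_of_nonneg_of_le zero_le ?_
      refine le_trans (le_of_eq ?_) (mul_le_mul_left (Finset.single_le_sum
        (f := fun i => F i * c ^ (-i)) (fun _ _ => zero_le) (Finset.mem_Icc.2 ⟨hi, h1⟩)) _)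
      rw [mul_assoc, ← ENNReal.zpow_add hc0 hc, neg_add_cancel, zpow_zero, mul_one]
    · obtain ⟨n, rfl⟩ : ∃ n : ℕ, i = n := ⟨i.toNat, by lia⟩
      obtain ⟨h2, h3⟩ := hN n (by lia)
      refine le_add_of_le_of_nonneg ?_ zero_le
      rw [zpow_natCast, ← ENNReal.rpow_natCast]
      have h4 : (n : ℝ) ≠ 0 := by positivity
      have h5 : F n = (F n ^ (1 / (n : ℝ))) ^ (n : ℝ) := by
        rw [← ENNReal.rpow_mul, one_div_mul_cancel h4, ENNReal.rpow_one]
      rw [h5]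
      exact ENNReal.rpow_le_rpow h2.le (by positivity)

/-- Geometric decay of `(c / d)^n` beats the linear factor. -/
theorem eventually_linear_mul_pow_le (K : ℕ) (D : ℝ≥0) {c d : ℝ≥0} (hcd : c < d) :
    ∀ᶠ n : ℕ in atTop, ((n + K : ℕ) : ℝ≥0∞) * (D * (c : ℝ≥0∞) ^ n) ≤ (d : ℝ≥0∞) ^ n := by
  have hd : (0 : ℝ) < d := lt_of_le_of_lt c.2 (NNReal.coe_lt_coe.2 hcd)
  have hr : (c : ℝ) / d < 1 := (div_lt_one hd).2 hcd
  have hr0 : 0 ≤ (c : ℝ) / d := by positivity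
  have h1 := (((tendsto_self_mul_const_pow_of_lt_one hr0 hr).add
    ((tendsto_pow_atTop_nhds_zero_of_lt_one hr0 hr).const_mul (K : ℝ))).const_mul (D : ℝ))
  rw [mul_zero, add_zero, mul_zero] at h1
  filter_upwards [h1.eventually_le_const zero_lt_one] with n hn
  have h2 : ((n : ℝ) + K) * (D * (c : ℝ) ^ n) ≤ (d : ℝ) ^ n := by
    rw [div_pow] at hn
    have h3 : (D : ℝ) * ((n : ℝ) * ((c : ℝ) ^ n / d ^ n) + K * ((c : ℝ) ^ n / d ^ n)) =
        (((n : ℝ) + K) * (D * (c : ℝ) ^ n)) / d ^ n := by ring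
    rw [h3, div_le_one (by positivity)] at hn
    exact hn
  have h4 : ((n : ℝ≥0) + K) * (D * c ^ n) ≤ d ^ n := by exact_mod_cast h2
  exact_mod_cast h4

theorem limsup_convolution_le (hF : ∀ i, F i ≠ ⊤) (hG : ∀ i, G i ≠ ⊤)
    (hU : ∀ n, U n ≤ ∑ i ∈ Finset.Icc p (n - q), F i * G (n - i)) :
    limsup (fun n : ℕ => U n ^ (1 / (n : ℝ))) atTop ≤
      max (limsup (fun n : ℕ => F n ^ (1 / (n : ℝ))) atTop)
        (limsup (fun n : ℕ => G n ^ (1 / (n : ℝ))) atTop) := by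
  refine le_of_forall_gt_imp_ge_of_dense fun d hd => ?_
  rcases eq_or_ne d ⊤ with rfl | hdt
  · exact le_top
  -- The gap between `c` and `d` absorbs the number of summands: each is at most `C * C' * c ^ n`,
  -- and there are at most `n + (1 - p - q).toNat` of them.
  obtain ⟨c, hc, hcd⟩ := exists_between hd
  have hct : c ≠ ⊤ := hcd.ne_top
  have hc0 : c ≠ 0 := (bot_le.trans_lt hc).ne'
  obtain ⟨C, hC, hFC⟩ := exists_zpow_bound hF p hct ((le_max_left _ _).trans_lt hc)
  obtain ⟨C', hC', hGC⟩ := exists_zpow_bound hG q hct ((le_max_right _ _).trans_lt hc)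
  lift c to ℝ≥0 using hct
  lift d to ℝ≥0 using hdt
  lift C to ℝ≥0 using hC
  lift C' to ℝ≥0 using hC'
  refine limsup_le_of_le (by isBoundedDefault) ?_
  filter_upwards [eventually_linear_mul_pow_le (1 - p - q).toNat (C * C')
    (ENNReal.coe_lt_coe.1 hcd), eventually_ge_atTop 1] with n hn hn1
  have h1 : U n ≤ ((n + (1 - p - q).toNat : ℕ) : ℝ≥0∞) * ((C * C' : ℝ≥0) * (c : ℝ≥0∞) ^ n) := by
    refine (hU n).trans ((Finset.sum_le_card_nsmul _ _
      ((C * C' : ℝ≥0) * (c : ℝ≥0∞) ^ n) fun i hi => ?_).trans ?_)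
    · rw [Finset.mem_Icc] at hi
      refine (mul_le_mul' (hFC i hi.1) (hGC (n - i) (by lia))).trans (le_of_eq ?_)
      have h2 : (c : ℝ≥0∞) ^ n = (c : ℝ≥0∞) ^ i * (c : ℝ≥0∞) ^ ((n : ℤ) - i) := by
        rw [← ENNReal.zpow_add hc0 ENNReal.coe_ne_top, add_sub_cancel, zpow_natCast]
      rw [h2, ENNReal.coe_mul]
      ring
    · rw [nsmul_eq_mul, Int.card_Icc]
      refine mul_le_mul_left ?_ _
      exact_mod_cast (by lia : ((n : ℤ) - q + 1 - p).toNat ≤ n + (1 - p - q).toNat)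
  have h4 : (n : ℝ) ≠ 0 := by positivity
  refine (ENNReal.rpow_le_rpow (h1.trans hn) (by positivity)).trans (le_of_eq ?_)
  rw [← ENNReal.rpow_natCast, ← ENNReal.rpow_mul, mul_one_div_cancel h4, ENNReal.rpow_one]

/-- Growth of degree at most `d - 1`. -/
def PolyGrowth (F : ℤ → ℝ≥0∞) (d : ℕ) : Prop :=
  ∃ c : ℝ≥0, ∀ᶠ n : ℕ in atTop, F n ≤ c * (n : ℝ≥0∞) ^ ((d : ℤ) - 1)

/-- The bound is stated with an auxiliary `m ≥ max(i, 1)` so that it also covers nonpositive indices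
and one `m` serves a whole sum. -/
theorem PolyGrowth.exists_bound (hF : ∀ i, F i ≠ ⊤) {d : ℕ} (h : PolyGrowth F (d + 1)) (p : ℤ) :
    ∃ C : ℝ≥0, ∀ i, p ≤ i → ∀ m : ℕ, i ≤ m → 1 ≤ m → F i ≤ C * (m : ℝ≥0∞) ^ d := by
  obtain ⟨c, hc⟩ := h
  obtain ⟨N, hN⟩ := eventually_atTop.1 hc
  have hD : c + ∑ i ∈ Finset.Icc p N, F i ≠ ⊤ :=
    ENNReal.add_ne_top.2 ⟨ENNReal.coe_ne_top, ENNReal.sum_ne_top.2 fun i _ => hF i⟩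
  obtain ⟨D, hD⟩ : ∃ D : ℝ≥0, (D : ℝ≥0∞) = _ := ⟨_, ENNReal.coe_toNNReal hD⟩
  refine ⟨D, fun i hi m him hm => ?_⟩
  rw [hD, add_mul]
  by_cases h1 : i ≤ N
  · refine le_add_of_nonneg_of_le zero_le ?_
    refine (Finset.single_le_sum (fun _ _ => zero_le) (Finset.mem_Icc.2 ⟨hi, h1⟩)).trans ?_
    exact le_mul_of_one_le_right zero_le (one_le_pow₀ (by exact_mod_cast hm))
  · obtain ⟨n, rfl⟩ : ∃ n : ℕ, i = n := ⟨i.toNat, by lia⟩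
    refine le_add_of_le_of_nonneg ((hN n (by lia)).trans ?_) zero_le
    rw [Nat.cast_succ, add_sub_cancel_right, zpow_natCast]
    gcongr
    exact_mod_cast him

/-- For `d = 0` the bound is `c / n`, eventually below `1`, which forces vanishing for
integer-valued functions. -/
theorem PolyGrowth.exists_eq_zero (hF : ∀ i, F i < 1 → F i = 0) (h : PolyGrowth F 0) :
    ∃ N : ℤ, ∀ i, N ≤ i → F i = 0 := by
  obtain ⟨c, hc⟩ := h
  obtain ⟨k, hk⟩ := exists_nat_gt c
  obtain ⟨N, hN⟩ := eventually_atTop.1 (hc.and (eventually_ge_atTop k))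
  refine ⟨N, fun i hi => hF i ?_⟩
  obtain ⟨n, rfl⟩ : ∃ n : ℕ, i = n := ⟨i.toNat, by lia⟩
  obtain ⟨h1, h2⟩ := hN n (by lia)
  refine h1.trans_lt ?_
  rw [Nat.cast_zero, zero_sub, zpow_neg_one, ← div_eq_mul_inv]
  have hcn : c < n := hk.trans_le (by exact_mod_cast h2)
  refine ENNReal.div_lt_of_lt_mul ?_
  rw [one_mul]
  exact_mod_cast hcn

theorem polyGrowth_of_le {C : ℝ≥0} {K d : ℕ}
    (h : ∀ᶠ n : ℕ in atTop, U n ≤ C * ((n + K : ℕ) : ℝ≥0∞) ^ d) : PolyGrowth U (d + 1) := by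
  refine ⟨C * 2 ^ d, ?_⟩
  filter_upwards [h, eventually_ge_atTop K] with n hn hK
  refine hn.trans ?_
  rw [Nat.cast_succ, add_sub_cancel_right, zpow_natCast, ENNReal.coe_mul, mul_assoc]
  refine mul_le_mul_right ?_ _
  rw [ENNReal.coe_pow, ← mul_pow]
  refine pow_le_pow_left₀ zero_le ?_ _
  exact_mod_cast (by lia : n + K ≤ 2 * n)

/-- Here `F` is eventually zero, so only a bounded number of translates of `G` contribute and the
degree does not increase. -/
theorem PolyGrowth.convolution_zero (hF : ∀ i, F i ≠ ⊤) (hG : ∀ i, G i ≠ ⊤)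
    (hF1 : ∀ i, F i < 1 → F i = 0)
    (hU : ∀ n, U n ≤ ∑ i ∈ Finset.Icc p (n - q), F i * G (n - i)) {e : ℕ}
    (h : PolyGrowth F 0) (h' : PolyGrowth G (e + 1)) : PolyGrowth U (e + 1) := by
  obtain ⟨N, hN⟩ := h.exists_eq_zero hF1
  obtain ⟨C, hC⟩ := h'.exists_bound hG q
  have hD : ∑ i ∈ Finset.Icc p N, F i ≠ ⊤ := ENNReal.sum_ne_top.2 fun i _ => hF i
  obtain ⟨D, hD⟩ : ∃ D : ℝ≥0, (D : ℝ≥0∞) = _ := ⟨_, ENNReal.coe_toNNReal hD⟩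
  refine polyGrowth_of_le (C := D * C) (K := (-p).toNat) ?_
  filter_upwards [eventually_ge_atTop 1] with n hn
  refine (hU n).trans ?_
  have h1 : ∑ i ∈ Finset.Icc p (n - q), F i * G (n - i) ≤
      ∑ i ∈ Finset.Icc p (n - q), F i * (C * ((n + (-p).toNat : ℕ) : ℝ≥0∞) ^ e) := by
    refine Finset.sum_le_sum fun i hi => mul_le_mul_right ?_ _
    rw [Finset.mem_Icc] at hi
    exact hC _ (by lia) _ (by push_cast; lia) (by lia)
  refine h1.trans ?_
  rw [← Finset.sum_mul, ENNReal.coe_mul, mul_assoc, hD]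
  refine mul_le_mul_left (Finset.sum_le_sum_of_ne_zero fun i hi h0 => ?_) _
  rw [Finset.mem_Icc] at hi ⊢
  exact ⟨hi.1, not_lt.1 fun h2 => h0 (hN i h2.le)⟩

theorem convolution_comm (n : ℤ) : ∑ i ∈ Finset.Icc p (n - q), F i * G (n - i) =
    ∑ i ∈ Finset.Icc q (n - p), G i * F (n - i) := by
  refine Finset.sum_nbij' (fun i => n - i) (fun i => n - i) ?_ ?_ ?_ ?_ ?_
  · intro i hi
    rw [Finset.mem_Icc] at hi ⊢
    lia
  · intro i hi
    rw [Finset.mem_Icc] at hi ⊢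
    lia
  · exact fun i _ => sub_sub_cancel n i
  · exact fun i _ => sub_sub_cancel n i
  · intro i _
    rw [sub_sub_cancel, mul_comm]

theorem PolyGrowth.convolution (hF : ∀ i, F i ≠ ⊤) (hG : ∀ i, G i ≠ ⊤)
    (hF1 : ∀ i, F i < 1 → F i = 0) (hG1 : ∀ i, G i < 1 → G i = 0)
    (hU : ∀ n, U n ≤ ∑ i ∈ Finset.Icc p (n - q), F i * G (n - i)) {d e : ℕ}
    (h : PolyGrowth F d) (h' : PolyGrowth G e) : PolyGrowth U (d + e) := by
  -- Zero exponents are separated because `d - 1` is then negative and the count of summands is no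
  -- longer the source of growth.
  match d, e with
  | 0, 0 =>
    obtain ⟨N, hN⟩ := h.exists_eq_zero hF1
    obtain ⟨N', hN'⟩ := h'.exists_eq_zero hG1
    refine ⟨0, ?_⟩
    filter_upwards [eventually_ge_atTop (N + N').toNat] with n hn
    refine (hU n).trans ((Finset.sum_eq_zero fun i _ => ?_).le.trans zero_le)
    by_cases h1 : N ≤ i
    · rw [hN i h1, zero_mul]
    · rw [hN' (n - i) (by lia), mul_zero]
  | 0, e + 1 =>
    rw [zero_add]
    exact h.convolution_zero hF hG hF1 hU h'
  | d + 1, 0 =>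
    rw [add_zero]
    exact h'.convolution_zero hG hF hG1 (fun n => (hU n).trans (convolution_comm n).le) h
  | d + 1, e + 1 =>
    obtain ⟨C, hC⟩ := h.exists_bound hF p
    obtain ⟨C', hC'⟩ := h'.exists_bound hG q
    -- With this choice `n + K` bounds `i`, `n - i` and the number of summands, and is at least `1`.
    let K := p.natAbs + q.natAbs + 1
    refine polyGrowth_of_le (C := C * C') (K := K) (d := d + 1 + e) (.of_forall fun n => ?_)
    have h1 : ∀ i ∈ Finset.Icc p (n - q), F i * G (n - i) ≤
        C * C' * ((n + K : ℕ) : ℝ≥0∞) ^ (d + e) := fun i hi => by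
      rw [Finset.mem_Icc] at hi
      refine (mul_le_mul' (hC i hi.1 (n + K) (by lia) (by lia))
        (hC' (n - i) (by lia) (n + K) (by lia) (by lia))).trans (le_of_eq ?_)
      ring
    refine (hU n).trans ((Finset.sum_le_card_nsmul _ _ _ h1).trans ?_)
    rw [nsmul_eq_mul, Int.card_Icc, ENNReal.coe_mul]
    have h2 : ((((n : ℤ) - q + 1 - p).toNat : ℕ) : ℝ≥0∞) ≤ ((n + K : ℕ) : ℝ≥0∞) := by
      exact_mod_cast (by lia : ((n : ℤ) - q + 1 - p).toNat ≤ n + K)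
    refine (mul_le_mul_left h2 _).trans (le_of_eq ?_)
    ring

theorem iInf_polyGrowth_le (h : ∀ d e : ℕ, PolyGrowth F d → PolyGrowth G e → PolyGrowth U (d + e)) :
    ⨅ (d : ℕ) (_ : PolyGrowth U d), (d : ℕ∞) ≤
      (⨅ (d : ℕ) (_ : PolyGrowth F d), (d : ℕ∞)) + ⨅ (d : ℕ) (_ : PolyGrowth G d), (d : ℕ∞) := by
  -- A finite infimum of natural numbers is attained.
  have key (F : ℤ → ℝ≥0∞) (hF : ⨅ (d : ℕ) (_ : PolyGrowth F d), (d : ℕ∞) ≠ ⊤) :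
      ∃ d : ℕ, PolyGrowth F d ∧ (d : ℕ∞) = ⨅ (d : ℕ) (_ : PolyGrowth F d), (d : ℕ∞) := by
    obtain ⟨a, ha⟩ := ENat.ne_top_iff_exists.1 hF
    have h1 : ⨅ (d : ℕ) (_ : PolyGrowth F d), (d : ℕ∞) < (a + 1 : ℕ) := by
      rw [← ha]
      exact_mod_cast Nat.lt_succ_self a
    obtain ⟨d, hd⟩ := iInf_lt_iff.1 h1
    obtain ⟨hd, hda⟩ := iInf_lt_iff.1 hd
    refine ⟨d, hd, le_antisymm ?_ (iInf₂_le d hd)⟩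
    rw [← ha]
    exact_mod_cast Nat.lt_succ_iff.1 (by exact_mod_cast hda)
  by_cases hF : ⨅ (d : ℕ) (_ : PolyGrowth F d), (d : ℕ∞) = ⊤
  · rw [hF, top_add]
    exact le_top
  by_cases hG : ⨅ (d : ℕ) (_ : PolyGrowth G d), (d : ℕ∞) = ⊤
  · rw [hG, add_top]
    exact le_top
  obtain ⟨d, hd, hd'⟩ := key F hF
  obtain ⟨e, he, he'⟩ := key G hG
  rw [← hd', ← he']
  exact (iInf₂_le (d + e) (h d e hd he)).trans (by push_cast; exact le_rfl)

theorem toENNReal_sum_mul (s : Finset ℤ) (f g : ℤ → ℕ∞) :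
    ((∑ i ∈ s, f i * g i : ℕ∞) : ℝ≥0∞) = ∑ i ∈ s, (f i : ℝ≥0∞) * (g i : ℝ≥0∞) := by
  refine (map_sum ENat.toENNRealRingHom _ _).trans (Finset.sum_congr rfl fun i _ => ?_)
  exact ENat.toENNReal_mul _ _

end Convolution

end LocalHomInvariants

end

/-! ### The inequalities for curvature and complexity -/

open LocalHomInvariants in
theorem proposition3p2 {R' R S : Type u}
    [CommRing R'] [IsLocalRing R'] [IsNoetherianRing R']
    [CommRing R] [IsLocalRing R] [IsNoetherianRing R]
    [CommRing S] [IsLocalRing S] [IsNoetherianRing S]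
    (ρ : R' →+* R) [IsLocalHom ρ] (φ : R →+* S) [IsLocalHom φ]
    (L : Cpx R) (hL : InDPlusF L) (M : Cpx S) (hM : InDPlusF M) :
    curv (φ.comp ρ) (derivedTensor φ L hL.bounded M) ≤ max (curv ρ L) (curv φ M) ∧
    cx (φ.comp ρ) (derivedTensor φ L hL.bounded M) ≤ cx ρ L + cx φ M := by
  obtain ⟨p, q, h⟩ := betti_derivedTensor_le ρ φ L hL.bounded hL.finBdd M hM.finBdd
  have hF (i : ℤ) : (betti ρ L i : ℝ≥0∞) ≠ ⊤ :=
    ENat.toENNReal_ne_top.2 (hL.finBdd.betti_ne_top ρ i)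
  have hG (i : ℤ) : (betti φ M i : ℝ≥0∞) ≠ ⊤ :=
    ENat.toENNReal_ne_top.2 (hM.finBdd.betti_ne_top φ i)
  -- Integrality of Betti numbers is what makes complexity zero mean eventual vanishing.
  have h1 (x : ℕ∞) (hx : (x : ℝ≥0∞) < 1) : (x : ℝ≥0∞) = 0 := by
    have h2 : x < 1 := by exact_mod_cast hx
    rw [Order.lt_one_iff.1 h2, ENat.toENNReal_zero]
  have hU (n : ℤ) : (betti (φ.comp ρ) (derivedTensor φ L hL.bounded M) n : ℝ≥0∞) ≤
      ∑ i ∈ Finset.Icc p (n - q), (betti ρ L i : ℝ≥0∞) * (betti φ M (n - i) : ℝ≥0∞) := by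
    rw [← toENNReal_sum_mul]
    exact ENat.toENNReal_le.2 (h n)
  let F (i : ℤ) : ℝ≥0∞ := betti ρ L i
  let G (i : ℤ) : ℝ≥0∞ := betti φ M i
  let U (i : ℤ) : ℝ≥0∞ := betti (φ.comp ρ) (derivedTensor φ L hL.bounded M) i
  have hFs (i : ℤ) : F i < 1 → F i = 0 := h1 _
  have hGs (i : ℤ) : G i < 1 → G i = 0 := h1 _
  exact ⟨limsup_convolution_le (F := F) (G := G) (U := U) hF hG hU,
    iInf_polyGrowth_le (F := F) (G := G) (U := U) fun d e hd he =>
      hd.convolution hF hG hFs hGs hU he⟩
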